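/- Let $M$ be a smooth (finite-dimensional, Hausdorff, second countable) manifold with a smooth closed 3-form $H$. On $T\oplus T^*$ consider the neutral inner product $\langle X+\xi,Y+\eta\rangle=\tfrac12(\xi(Y)+\eta(X))$ and the $H$-twisted Courant bracket $$[X+\xi,Y+\eta]=[X,Y]+L_X\eta-L_Y\xi+\tfrac12 d(\xi(Y)-\eta(X))+i_Yi_XH .$$ A generalized almost complex structure is a smooth $\mathbf J\in\mathrm{End}(T\oplus T^*)$ with $\mathbf J^2=-1$ that is orthogonal for $\langle\,,\rangle$; it is a generalized complex structure if the smooth sections of its $\sqrt{-1}$-eigenbundle in $(T\oplus T^*)\otimes\mathbb C$ are closed under the bracket. A generalized Kähler structure is a pair of commuting generalized complex structures $(\mathbf J_1,\mathbf J_2)$ such that $\langle-\mathbf J_1\mathbf J_2\,\cdot,\cdot\rangle$ is positive definite. For a 2-form $K$ write $e^K(X+\xi)=X+\xi+i_XK$. Let $T\subset\mathbb R$ be an interval with more than one point and with $0\in T$. Let $(\mathbf J_1^t,\mathbf J_2^t)$, $t\in T$, be a one-parameter family, smooth in $(t,x)\in T\times M$, of pairs of generalized almost complex structures such that $(\mathbf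 J_1^0,\mathbf J_2^0)$ is generalized Kähler, and let $K_t$, $t\in T$, be a family of 2-forms, smooth in $(t,x)$, such that for all $t\in T$ $$\frac{\partial}{\partial t}\mathbf J_1^t=[\mathbf J_1^t,e^{K_t}\mathbf J_1^t],\qquad \frac{\partial}{\partial t}\mathbf J_2^t=[\mathbf J_2^t,e^{K_t}\mathbf J_2^t].$$ Then $(\mathbf J_1^t,\mathbf J_2^t)$ is a generalized Kähler structure for all $t\in T$ if and only if for all $t\in T$ 1. $K_t$ is of type $(1,1)$ with respect to $J^t$, i.e. $K_t(J^tX,J^tY)=K_t(X,Y)$ for all $X,Y$; 2. $dK_t=0$; 3. $\langle-\mathbf J_1^t\mathbf J_2^t v,v\rangle>0$ for all $0\neq v\in T\oplus T^*$. Here $J^t$ is the endomorphism of $TM$ determined by $(\mathbf J_1^t,\mathbf J_2^t)$ through the Gualtieri map: write $-\mathbf J_1^t\mathbf J_2^t=\begin{pmatrix}A&g^{-1}\\ *&*\end{pmatrix}$ with respect to $T\oplus T^*$ (the block $T^*\to T$ is invertible by 3), put $b=-gA$ and $e^{b}=\begin{pmatrix}1&0\\ b&1\end{pmatrix}$, and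 let $J^t$ be the $T\to T$ block of $e^{-b}(\mathbf J_1^t-\mathbf J_2^t)e^{b}$. If the pair is generalized Kähler, this is the complex structure $J$ of its bihermitian data $(g,I,J,b)$, for which $$\mathbf J_{1/2}^t=\tfrac12e^b\begin{pmatrix}I\pm J&-(\omega_I^{-1}\mp\omega_J^{-1})\\ \omega_I\mp\omega_J&-(I^*\pm J^*)\end{pmatrix}e^{-b}.$$ -/

import Mathlib

open Bundle Manifold ContDiff Set

noncomputable section

namespace GenKahler

/-! ### Linear algebra of `W ⊕ W*` -/

section Fiber

variable {W : Type*} [AddCommGroup W] [Module ℝ W] [TopologicalSpace W]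

/-- The generalized vector space `W ⊕ W*`. -/
abbrev Gen (W : Type*) [AddCommGroup W] [Module ℝ W] [TopologicalSpace W] : Type _ :=
  W × (W →L[ℝ] ℝ)

/-- The neutral inner product `⟨X + ξ, Y + η⟩ = (ξ(Y) + η(X)) / 2`. -/
def pairing (u v : Gen W) : ℝ := (1 / 2 : ℝ) * (u.2 v.1 + v.2 u.1)

/-- The contraction `i_X K = K(X, ·)` of a 2-form. -/
def contract (K : W [⋀^Fin 2]→L[ℝ] ℝ) (X : W) : W →L[ℝ] ℝ := K.toContinuousLinearMap ![X, 0] 1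

lemma contract_apply (K : W [⋀^Fin 2]→L[ℝ] ℝ) (X Y : W) : contract K X Y = K ![X, Y] := by
  have h : Function.update ![X, 0] 1 Y = ![X, Y] := by
    ext i; fin_cases i <;> simp
  change K (Function.update ![X, 0] 1 Y) = K ![X, Y]
  rw [h]

variable [IsTopologicalAddGroup W] [ContinuousSMul ℝ W]

/-- `G = - 𝐉₁ 𝐉₂`. -/
def genMetric (J₁ J₂ : Gen W →L[ℝ] Gen W) : Gen W →L[ℝ] Gen W := -(J₁ ∘L J₂)

/-- `⟨- 𝐉₁ 𝐉₂ v, v⟩ > 0` for all `v ≠ 0`. -/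
def IsPositivePair (J₁ J₂ : Gen W →L[ℝ] Gen W) : Prop :=
  ∀ v : Gen W, v ≠ 0 → 0 < pairing (genMetric J₁ J₂ v) v

/-- A 2-form as a linear map `W → W*`, `X ↦ K(X, ·)`. -/
def flat [T2Space W] [FiniteDimensional ℝ W] (K : W [⋀^Fin 2]→L[ℝ] ℝ) : W →L[ℝ] (W →L[ℝ] ℝ) :=
  LinearMap.toContinuousLinearMap
    { toFun := contract K
      map_add' := fun X Y => by
        ext Z
        simpa [contract_apply] using K.cons_add ![Z] X Y
      map_smul' := fun c X => by
        ext Z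
        simpa [contract_apply] using K.cons_smul ![Z] c X }

lemma flat_apply [T2Space W] [FiniteDimensional ℝ W] (K : W [⋀^Fin 2]→L[ℝ] ℝ) (X Y : W) :
    flat K X Y = K ![X, Y] := by
  simp [flat, contract_apply]

/-- The transformation `e^B (X + ξ) = X + ξ + B X` given by a linear map `B : W → W*`. -/
def expB (B : W →L[ℝ] (W →L[ℝ] ℝ)) : Gen W →L[ℝ] Gen W :=
  (ContinuousLinearMap.fst ℝ W (W →L[ℝ] ℝ)).prod
    (ContinuousLinearMap.snd ℝ W (W →L[ℝ] ℝ) + B ∘L ContinuousLinearMap.fst ℝ W (W →L[ℝ] ℝ))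

/-- `Φ_K(𝐉) = [𝐉, e^K 𝐉]`. -/
def Phi [T2Space W] [FiniteDimensional ℝ W] (K : W [⋀^Fin 2]→L[ℝ] ℝ)
    (J : Gen W →L[ℝ] Gen W) : Gen W →L[ℝ] Gen W :=
  J ∘L (expB (flat K) ∘L J) - (expB (flat K) ∘L J) ∘L J

/-- A 2-form `K` is of type `(1,1)` with respect to `J`. -/
def IsOneOne (J : W →L[ℝ] W) (K : W [⋀^Fin 2]→L[ℝ] ℝ) : Prop :=
  ∀ X Y : W, K ![J X, J Y] = K ![X, Y]

/-- The dual map `A* : W* → W*`. -/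
def dualMap (A : W →L[ℝ] W) : (W →L[ℝ] ℝ) →L[ℝ] (W →L[ℝ] ℝ) :=
  ContinuousLinearMap.precomp ℝ A

/-- The block matrix `(a b; c d)` acting on `W ⊕ W*`. -/
def block (a : W →L[ℝ] W) (b : (W →L[ℝ] ℝ) →L[ℝ] W) (c : W →L[ℝ] (W →L[ℝ] ℝ))
    (d : (W →L[ℝ] ℝ) →L[ℝ] (W →L[ℝ] ℝ)) : Gen W →L[ℝ] Gen W :=
  (a.coprod b).prod (c.coprod d)

/-- Bihermitian data `(g, I, J, b)` on a vector space: `g` is a Euclidean metric, `I` and `J` are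
`g`-orthogonal complex structures and `b` is a 2-form. -/
structure IsBihermitian (g : W ≃L[ℝ] (W →L[ℝ] ℝ)) (b : W →L[ℝ] (W →L[ℝ] ℝ)) (I J : W →L[ℝ] W) :
    Prop where
  symm : ∀ X Y, g X Y = g Y X
  pos : ∀ X, X ≠ 0 → 0 < g X X
  skew : ∀ X Y, b X Y = - b Y X
  I_sq : ∀ X, I (I X) = -X
  J_sq : ∀ X, J (J X) = -X
  I_orth : ∀ X Y, g (I X) (I Y) = g X Y
  J_orth : ∀ X Y, g (J X) (J Y) = g X Y

/-- The Gualtieri map with sign `s = ±1`: with `ω_I = g I`, `ω_J = g J`,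
`𝐉 = (1/2) e^b (I + s J, -(ω_I⁻¹ - s ω_J⁻¹); ω_I - s ω_J, -(I* + s J*)) e^{-b}`.
The sign `s = 1` gives `𝐉₁` and `s = -1` gives `𝐉₂`. -/
def gualtieriMap (s : ℝ) (g : W ≃L[ℝ] (W →L[ℝ] ℝ)) (b : W →L[ℝ] (W →L[ℝ] ℝ)) (I J : W →L[ℝ] W) :
    Gen W →L[ℝ] Gen W :=
  let ωI : W →L[ℝ] (W →L[ℝ] ℝ) := (g : W →L[ℝ] (W →L[ℝ] ℝ)) ∘L I
  let ωJ : W →L[ℝ] (W →L[ℝ] ℝ) := (g : W →L[ℝ] (W →L[ℝ] ℝ)) ∘L J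
  (1 / 2 : ℝ) • (expB b ∘L
    block (I + s • J) (-(ωI.inverse - s • ωJ.inverse)) (ωI - s • ωJ)
      (-(dualMap I + s • dualMap J)) ∘L expB (-b))

/-- For `G = - 𝐉₁ 𝐉₂ = (A, g⁻¹; *, *)`, the block `g⁻¹ : W* → W`. -/
def cometric (J₁ J₂ : Gen W →L[ℝ] Gen W) : (W →L[ℝ] ℝ) →L[ℝ] W :=
  ContinuousLinearMap.fst ℝ W (W →L[ℝ] ℝ) ∘L genMetric J₁ J₂ ∘L
    ContinuousLinearMap.inr ℝ W (W →L[ℝ] ℝ)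

/-- For `G = - 𝐉₁ 𝐉₂ = (A, g⁻¹; *, *)`, the block `A : W → W`. -/
def blockA (J₁ J₂ : Gen W →L[ℝ] Gen W) : W →L[ℝ] W :=
  ContinuousLinearMap.fst ℝ W (W →L[ℝ] ℝ) ∘L genMetric J₁ J₂ ∘L
    ContinuousLinearMap.inl ℝ W (W →L[ℝ] ℝ)

/-- The map `b = - g A : W → W*` (a 2-form if the pair comes from bihermitian data). -/
def gualtieriB (J₁ J₂ : Gen W →L[ℝ] Gen W) : W →L[ℝ] (W →L[ℝ] ℝ) :=
  -((cometric J₁ J₂).inverse ∘L blockA J₁ J₂)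

/-- The structure `J` determined by `(𝐉₁, 𝐉₂)` through the Gualtieri map: the upper left block of
`e^{-b} (𝐉₁ - 𝐉₂) e^b`, where `b = - g A`. It makes sense as soon as the block `g⁻¹` is invertible,
in particular for positive pairs that are not assumed to commute; by `gualtieriJ_gualtieriMap`
it inverts the Gualtieri map. -/
def gualtieriJ (J₁ J₂ : Gen W →L[ℝ] Gen W) : W →L[ℝ] W :=
  ContinuousLinearMap.fst ℝ W (W →L[ℝ] ℝ) ∘L
    (expB (-(gualtieriB J₁ J₂)) ∘L (J₁ - J₂) ∘L expB (gualtieriB J₁ J₂)) ∘L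
    ContinuousLinearMap.inl ℝ W (W →L[ℝ] ℝ)

lemma gualtieriMap_apply {g : W ≃L[ℝ] (W →L[ℝ] ℝ)} {b : W →L[ℝ] (W →L[ℝ] ℝ)} {I J : W →L[ℝ] W}
    (h : IsBihermitian g b I J) (s : ℝ) (X Y : W) :
    gualtieriMap s g b I J (X, b X + g Y) =
      ((1 / 2 : ℝ) • (I X + s • J X + I Y - s • J Y),
        b ((1 / 2 : ℝ) • (I X + s • J X + I Y - s • J Y)) +
          g ((1 / 2 : ℝ) • (I X - s • J X + I Y + s • J Y))) := by
  have inv : ∀ A : W →L[ℝ] W, (∀ X, A (A X) = -X) → ∀ Z,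
      ((g : W →L[ℝ] (W →L[ℝ] ℝ)) ∘L A).inverse (g Z) = -(A Z) := by
    intro A hA Z
    have e : ((g : W →L[ℝ] (W →L[ℝ] ℝ)) ∘L A).inverse
        = -(A ∘L (g.symm : (W →L[ℝ] ℝ) →L[ℝ] W)) := by
      apply ContinuousLinearMap.inverse_eq
      · ext ξ Z
        simp [hA]
      · ext Z
        simp [hA]
    simp [e]
  have dual : ∀ A : W →L[ℝ] W, (∀ X, A (A X) = -X) → (∀ X Y, g (A X) (A Y) = g X Y) → ∀ Z,
      dualMap A (g Z) = -(g (A Z)) := by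
    intro A hA hA' Z
    ext V
    have := hA' (A Z) V
    simp only [hA, map_neg, _root_.neg_apply] at this
    change g Z (A V) = -(g (A Z) V)
    linarith
  have e1 : expB (-b) (X, b X + g Y) = (X, g Y) := by
    simp [expB]
  have e2 : ∀ U V : W, expB b (U, g V) = (U, b U + g V) := by
    intro U V
    exact Prod.ext rfl (add_comm _ _)
  simp only [gualtieriMap, _root_.smul_apply, ContinuousLinearMap.comp_apply, e1]
  have e3 : block (I + s • J)
      (-(((g : W →L[ℝ] (W →L[ℝ] ℝ)) ∘L I).inverse - s • ((g : W →L[ℝ] (W →L[ℝ] ℝ)) ∘L J).inverse))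
      ((g : W →L[ℝ] (W →L[ℝ] ℝ)) ∘L I - s • ((g : W →L[ℝ] (W →L[ℝ] ℝ)) ∘L J))
      (-(dualMap I + s • dualMap J)) (X, g Y) =
      (I X + s • J X + I Y - s • J Y, g (I X - s • J X + I Y + s • J Y)) := by
    simp only [block, ContinuousLinearMap.prod_apply, ContinuousLinearMap.coprod_apply,
      _root_.add_apply, _root_.sub_apply, _root_.neg_apply,
      _root_.smul_apply, inv I h.I_sq, inv J h.J_sq, dual I h.I_sq h.I_orth,
      dual J h.J_sq h.J_orth, ContinuousLinearMap.comp_apply, map_add, map_sub, map_smul,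
      ContinuousLinearEquiv.coe_coe]
    refine Prod.ext ?_ ?_
    · simp only [smul_neg]; abel
    · simp only [smul_neg]; abel
  rw [e3, e2]
  simp

/-- On bihermitian data, `gualtieriJ` inverts the Gualtieri map. -/
lemma gualtieriJ_gualtieriMap {g : W ≃L[ℝ] (W →L[ℝ] ℝ)} {b : W →L[ℝ] (W →L[ℝ] ℝ)}
    {I J : W →L[ℝ] W} (h : IsBihermitian g b I J) :
    gualtieriJ (gualtieriMap 1 g b I J) (gualtieriMap (-1) g b I J) = J := by
  have hG : ∀ X Y : W, genMetric (gualtieriMap 1 g b I J) (gualtieriMap (-1) g b I J)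
      (X, b X + g Y) = (Y, b Y + g X) := by
    intro X Y
    have c1 : (1 / 2 : ℝ) • (I ((1 / 2 : ℝ) • (I X + (-1 : ℝ) • J X + I Y - (-1 : ℝ) • J Y))
        + (1 : ℝ) • J ((1 / 2 : ℝ) • (I X + (-1 : ℝ) • J X + I Y - (-1 : ℝ) • J Y))
        + I ((1 / 2 : ℝ) • (I X - (-1 : ℝ) • J X + I Y + (-1 : ℝ) • J Y))
        - (1 : ℝ) • J ((1 / 2 : ℝ) • (I X - (-1 : ℝ) • J X + I Y + (-1 : ℝ) • J Y))) = -Y := by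
      simp only [map_smul, map_add, map_sub, h.I_sq, h.J_sq]
      module
    have c2 : (1 / 2 : ℝ) • (I ((1 / 2 : ℝ) • (I X + (-1 : ℝ) • J X + I Y - (-1 : ℝ) • J Y))
        - (1 : ℝ) • J ((1 / 2 : ℝ) • (I X + (-1 : ℝ) • J X + I Y - (-1 : ℝ) • J Y))
        + I ((1 / 2 : ℝ) • (I X - (-1 : ℝ) • J X + I Y + (-1 : ℝ) • J Y))
        + (1 : ℝ) • J ((1 / 2 : ℝ) • (I X - (-1 : ℝ) • J X + I Y + (-1 : ℝ) • J Y))) = -X := by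
      simp only [map_smul, map_add, map_sub, h.I_sq, h.J_sq]
      module
    simp only [genMetric, _root_.neg_apply, ContinuousLinearMap.comp_apply]
    rw [gualtieriMap_apply h, gualtieriMap_apply h, c1, c2]
    simp [add_comm]
  have hc : cometric (gualtieriMap 1 g b I J) (gualtieriMap (-1) g b I J)
      = (g.symm : (W →L[ℝ] ℝ) →L[ℝ] W) := by
    refine ContinuousLinearMap.ext fun ξ => ?_
    have := hG 0 (g.symm ξ)
    simp only [map_zero, zero_add, ContinuousLinearEquiv.apply_symm_apply, add_zero] at this
    simp [cometric, this]
  have hA : ∀ X, blockA (gualtieriMap 1 g b I J) (gualtieriMap (-1) g b I J) X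
      = -(g.symm (b X)) := by
    intro X
    have := hG X (-(g.symm (b X)))
    simp only [map_neg, ContinuousLinearEquiv.apply_symm_apply, add_neg_cancel] at this
    simp [blockA, this]
  have hb : gualtieriB (gualtieriMap 1 g b I J) (gualtieriMap (-1) g b I J) = b := by
    refine ContinuousLinearMap.ext fun X => ?_
    simp [gualtieriB, hc, hA]
  refine ContinuousLinearMap.ext fun X => ?_
  have h1 := gualtieriMap_apply h 1 X 0
  have h2 := gualtieriMap_apply h (-1) X 0
  simp only [map_zero, add_zero] at h1 h2
  simp only [gualtieriJ, hb, ContinuousLinearMap.comp_apply, ContinuousLinearMap.inl_apply]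
  have e : expB b (X, 0) = (X, b X) := by simp [expB]
  rw [e, _root_.sub_apply, h1, h2]
  simp only [expB, ContinuousLinearMap.prod_apply, ContinuousLinearMap.coe_fst',
    Prod.fst_sub]
  simp only [smul_zero, sub_zero]
  module

end Fiber

/-! ### The manifold -/

section Manifold

variable {E : Type*} [NormedAddCommGroup E] [NormedSpace ℝ E]
  {M : Type*} [TopologicalSpace M] [ChartedSpace E M]

instance instT2Tangent (x : M) : T2Space (TangentSpace 𝓘(ℝ, E) x) := inferInstanceAs (T2Space E)

instance instFinDimTangent [h : FiniteDimensional ℝ E] (x : M) :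
    FiniteDimensional ℝ (TangentSpace 𝓘(ℝ, E) x) := h

variable (E M) in
/-- A differential form of degree `k` on `M` (not necessarily smooth). -/
abbrev Form (k : ℕ) : Type _ := (x : M) → (TangentSpace 𝓘(ℝ, E) x) [⋀^Fin k]→L[ℝ] ℝ

/-- The coordinate expression of a form in the chart at `x₀`. -/
def formInChart {k : ℕ} (α : Form E M k) (x₀ : M) (y : E) : E [⋀^Fin k]→L[ℝ] ℝ :=
  (α ((extChartAt 𝓘(ℝ, E) x₀).symm y)).compContinuousLinearMap
    (mfderiv 𝓘(ℝ, E) 𝓘(ℝ, E) (extChartAt 𝓘(ℝ, E) x₀).symm y)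

/-- A form is smooth if its coordinate expressions are. -/
def IsSmoothForm {k : ℕ} (α : Form E M k) : Prop :=
  ∀ x₀ : M, ContDiffOn ℝ ∞ (formInChart α x₀) (extChartAt 𝓘(ℝ, E) x₀).target

/-- A family of forms is smooth, in the parameter `t ∈ T` and the point jointly, if its coordinate
expressions are. -/
def IsSmoothFormFamily {k : ℕ} (T : Set ℝ) (α : ℝ → Form E M k) : Prop :=
  ∀ x₀ : M, ContDiffOn ℝ ∞ (fun p : ℝ × E => formInChart (α p.1) x₀ p.2)
    (T ×ˢ (extChartAt 𝓘(ℝ, E) x₀).target)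

/-- The exterior derivative, computed at `x` in the chart at `x`. -/
def extD {k : ℕ} (α : Form E M k) : Form E M (k + 1) := fun x =>
  (extDeriv (formInChart α x) (extChartAt 𝓘(ℝ, E) x x)).compContinuousLinearMap
    (mfderiv 𝓘(ℝ, E) 𝓘(ℝ, E) (extChartAt 𝓘(ℝ, E) x) x)

variable (E M) in
/-- A section of `T ⊕ T*` (not necessarily smooth). -/
abbrev GenField : Type _ := (x : M) → Gen (TangentSpace 𝓘(ℝ, E) x)

variable (E M) in
/-- A section of `End (T ⊕ T*)` (not necessarily smooth). -/
abbrev GenEndo : Type _ :=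
  (x : M) → (Gen (TangentSpace 𝓘(ℝ, E) x) →L[ℝ] Gen (TangentSpace 𝓘(ℝ, E) x))

variable (E M) in
/-- The bundle `T ⊕ T*`. -/
abbrev GenBundle : M → Type _ :=
  (TangentSpace 𝓘(ℝ, E) : M → Type _) ×ᵇ (fun x : M => TangentSpace 𝓘(ℝ, E) x →L[ℝ] ℝ)

/-- The differential of a real function at `x`, as a covector. -/
def dFun (f : M → ℝ) (x : M) : TangentSpace 𝓘(ℝ, E) x →L[ℝ] ℝ := mfderiv 𝓘(ℝ, E) 𝓘(ℝ, ℝ) f x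

/-- A section of `T*` as a form of degree 1. -/
def toOneForm (η : (x : M) → (TangentSpace 𝓘(ℝ, E) x →L[ℝ] ℝ)) : Form E M 1 := fun x =>
  ContinuousAlternatingMap.ofSubsingleton ℝ (TangentSpace 𝓘(ℝ, E) x) ℝ (0 : Fin 1) (η x)

/-- The Lie derivative of a 1-form, `L_X η = i_X dη + d (η(X))`. -/
def lieDer (X : (x : M) → TangentSpace 𝓘(ℝ, E) x)
    (η : (x : M) → (TangentSpace 𝓘(ℝ, E) x →L[ℝ] ℝ)) (x : M) : TangentSpace 𝓘(ℝ, E) x →L[ℝ] ℝ :=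
  contract (extD (toOneForm η) x) (X x) + dFun (fun y => η y (X y)) x

variable [FiniteDimensional ℝ E]

/-- The Courant bracket twisted by `H`:
`[X + ξ, Y + η] = [X, Y] + L_X η - L_Y ξ + (1/2) d (ξ(Y) - η(X)) + i_Y i_X H`. -/
def courant (H : Form E M 3) (u v : GenField E M) : GenField E M := fun x =>
  (VectorField.mlieBracket 𝓘(ℝ, E) (fun y => (u y).1) (fun y => (v y).1) x,
    lieDer (fun y => (u y).1) (fun y => (v y).2) x
      - lieDer (fun y => (v y).1) (fun y => (u y).2) x
      + (1 / 2 : ℝ) • dFun (fun y => (u y).2 (v y).1 - (v y).2 (u y).1) x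
      + (H x).toContinuousLinearMap ![(u x).1, (v x).1, 0] 2)

variable [IsManifold 𝓘(ℝ, E) ∞ M]

/-- Smooth sections of `T ⊕ T*`. -/
def IsSmoothField (u : GenField E M) : Prop :=
  ContMDiff 𝓘(ℝ, E) (𝓘(ℝ, E).prod 𝓘(ℝ, E × (E →L[ℝ] ℝ))) ∞
    (fun x => TotalSpace.mk' (E × (E →L[ℝ] ℝ)) (E := GenBundle E M) x (u x))

/-- Smooth sections of `End (T ⊕ T*)`. -/
def IsSmoothEndo (J : GenEndo E M) : Prop :=
  ContMDiff 𝓘(ℝ, E)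
    (𝓘(ℝ, E).prod 𝓘(ℝ, (E × (E →L[ℝ] ℝ)) →L[ℝ] (E × (E →L[ℝ] ℝ)))) ∞
    (fun x => TotalSpace.mk' ((E × (E →L[ℝ] ℝ)) →L[ℝ] (E × (E →L[ℝ] ℝ)))
      (E := fun x : M => GenBundle E M x →L[ℝ] GenBundle E M x) x (J x))

/-- Families of sections of `End (T ⊕ T*)` that are smooth in `t ∈ T` and the point jointly. -/
def IsSmoothEndoFamily (T : Set ℝ) (J : ℝ → GenEndo E M) : Prop :=
  ContMDiffOn (𝓘(ℝ, ℝ).prod 𝓘(ℝ, E))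
    (𝓘(ℝ, E).prod 𝓘(ℝ, (E × (E →L[ℝ] ℝ)) →L[ℝ] (E × (E →L[ℝ] ℝ)))) ∞
    (fun p : ℝ × M => TotalSpace.mk' ((E × (E →L[ℝ] ℝ)) →L[ℝ] (E × (E →L[ℝ] ℝ)))
      (E := fun x : M => GenBundle E M x →L[ℝ] GenBundle E M x) p.2 (J p.1 p.2))
    (T ×ˢ (univ : Set M))

/-- A generalized almost complex structure: a smooth endomorphism of `T ⊕ T*` with `𝐉² = -1` that
is orthogonal for the neutral inner product. -/
structure IsGenAlmostComplex (J : GenEndo E M) : Prop where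
  smooth : IsSmoothEndo J
  sq : ∀ (x : M) (v : Gen (TangentSpace 𝓘(ℝ, E) x)), J x (J x v) = -v
  orth : ∀ (x : M) (v w : Gen (TangentSpace 𝓘(ℝ, E) x)), pairing (J x v) (J x w) = pairing v w

/-- The complex section `u + √-1 v` of `(T ⊕ T*) ⊗ ℂ` takes values in the `√-1`-eigenbundle of
`J`, i.e. `J u + √-1 J v = √-1 (u + √-1 v)`. -/
def IsEigenSection (J : GenEndo E M) (u v : GenField E M) : Prop :=
  ∀ x, J x (u x) = -(v x) ∧ J x (v x) = u x

/-- The `√-1`-eigenbundle of `J` is closed under the (complex bilinear extension of the) twisted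
Courant bracket,
`[u + √-1 v, u' + √-1 v'] = [u, u'] - [v, v'] + √-1 ([u, v'] + [v, u'])`. -/
def IsIntegrable (H : Form E M 3) (J : GenEndo E M) : Prop :=
  ∀ u v u' v' : GenField E M,
    IsSmoothField u → IsSmoothField v → IsSmoothField u' → IsSmoothField v' →
    IsEigenSection J u v → IsEigenSection J u' v' →
    IsEigenSection J (fun x => courant H u u' x - courant H v v' x)
      (fun x => courant H u v' x + courant H v u' x)

/-- A generalized complex structure (for the bracket twisted by `H`). -/
structure IsGenComplex (H : Form E M 3) (J : GenEndo E M) : Prop where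
  almost : IsGenAlmostComplex J
  integrable : IsIntegrable H J

/-- A generalized Kähler structure: two commuting generalized complex structures such that
`⟨- 𝐉₁ 𝐉₂ ·, ·⟩` is positive definite (it is symmetric since `𝐉₁` and `𝐉₂` commute). -/
structure IsGenKahler (H : Form E M 3) (J₁ J₂ : GenEndo E M) : Prop where
  fst : IsGenComplex H J₁
  snd : IsGenComplex H J₂
  comm : ∀ x, J₁ x ∘L J₂ x = J₂ x ∘L J₁ x
  pos : ∀ x, IsPositivePair (J₁ x) (J₂ x)

end Manifold

end GenKahler

end

noncomputable section

set_option synthInstance.maxHeartbeats 400000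

namespace GenKahler

/-! Since `𝐉² = -1`, both evolution equations read `𝐉' = K + 𝐉 K 𝐉`, where `K` stands for the
nilpotent map `X + ξ ↦ i_X K`. Positivity is assumed or known in each direction, so two
correspondences remain: commutation with type `(1,1)`, and integrability with closedness.

Commutation. For a commuting pair, `G = -J₁J₂` is an involution, `N = 1 - G` is twice the projection
to its `(-1)`-eigenspace, and `J` is the restriction of `J₁` to that eigenspace, carried to `T` by
the projection. The derivative of the commutator `C = J₁J₂ - J₂J₁` is then `(J₁ - J₂) K N - N K (J₁
- J₂)`, and it vanishes exactly when `K` is of type `(1,1)` (`PairRel.oneOne_iff`). If the pairs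
commute for all `t`, then `C' = 0` and `K` is of type `(1,1)`. In the other direction commutation is
not known in advance. The same identity is applied in the ring of continuous functions on a compact
interval modulo functions bounded by a multiple of `‖C‖`, where `J₁` and `J₂` do commute. It yields
`‖C'‖ ≤ c ‖C‖` (`flowCommutator_bound`), and Gronwall's inequality gives `C = 0`.

Integrability. Put `B = ∫₀ᵗ K`. Then `e^{-√-1 B}` maps the `√-1`-eigenbundle of the initial
structure to that of the structure at time `t` (`eigen_transport`). With `π` the projection to `T`,
the bracket obeys `[e^{-√-1 B} a, e^{-√-1 B} a'] = e^{-√-1 B} [a, a'] - √-1 dB(πa, πa', ·)`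
(`courantJet_gauge_re`, `courantJet_gauge_im`). If `dK = 0`, then `dB = 0` and integrability is
transported. Conversely, if the structures at times `0` and `t` are integrable, then `dB(πa, πa',
·)` lies in the initial eigenbundle whenever `a` and `a'` do, for both structures. On the
`(+1)`-eigenspace of `G`, which meets `T*` only in zero, this forces `dB(X, Y, Z) = dB(IX, IY, Z)`.
A 3-form with this symmetry is zero (`IsFiberPair.threeForm_eq_zero`), and differentiating `dB = 0`
in `t` gives `dK = 0`. -/

/-! ### Commuting structures in a ring -/

section Ring

variable {R : Type*} [Ring R]

/-- The elements of a ring that model a commuting pair `(J₁, J₂)` on `W ⊕ W*` together with its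
bihermitian data: `p` and `q` are the projections to `W` and `W*`, `γ` is the metric, and `e`, `f`
are the embedding `X ↦ X + bX` and its transpose. -/
structure RingPair (J₁ J₂ p q γ e f G N : R) : Prop where
  sq₁ : J₁ * J₁ = -1
  sq₂ : J₂ * J₂ = -1
  comm : J₁ * J₂ = J₂ * J₁
  hq : q = 1 - p
  pp : p * p = p
  pγ : p * γ = 0
  γp : γ * p = γ
  hG : G = -(J₁ * J₂)
  γG : γ * G * q = q
  Gγ : p * G * γ = p
  he : e = p - γ * G * p
  hf : f = q - q * G * γ
  hN : N = 1 - G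

namespace RingPair

variable {J₁ J₂ p q γ e f G N : R} (h : RingPair J₁ J₂ p q γ e f G N)
include h

lemma G_comm : G * J₁ = J₁ * G := by
  rw [h.hG, neg_mul, mul_neg, mul_assoc, ← h.comm]

lemma G_sq : G * G = 1 := by
  have : G * G = J₁ * (J₂ * J₁) * J₂ := by rw [h.hG]; noncomm_ring
  rw [this, ← h.comm, ← mul_assoc, h.sq₁, mul_assoc, h.sq₂]; simp

lemma sub_eq : J₁ - J₂ = J₁ * N := by
  rw [h.hN, h.hG]
  have : J₁ * (1 - -(J₁ * J₂)) = J₁ + (J₁ * J₁) * J₂ := by noncomm_ring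
  rw [this, h.sq₁]; noncomm_ring

lemma N_comm : N * J₁ = J₁ * N := by
  rw [h.hN, sub_mul, mul_sub, h.G_comm]; simp

lemma GN : G * N = -N := by
  rw [h.hN, mul_sub, h.G_sq]; noncomm_ring

lemma NG : N * G = -N := by
  rw [h.hN, sub_mul, h.G_sq]; noncomm_ring

lemma pGe : p * G * e = 0 := by
  rw [h.he, mul_sub, ← mul_assoc, ← mul_assoc, h.Gγ, sub_self]

lemma pe : p * e = p := by
  rw [h.he, mul_sub, h.pp, ← mul_assoc, ← mul_assoc, h.pγ]; simp

lemma ep : e * p = e := by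
  rw [h.he, sub_mul, h.pp, mul_assoc (γ * G), h.pp]

lemma pNe : p * N * e = p := by
  rw [h.hN, mul_sub, sub_mul, h.pGe, mul_one, h.pe, sub_zero]

lemma qγ : q * γ = γ := by rw [h.hq, sub_mul, h.pγ]; simp

lemma γq : γ * q = 0 := by rw [h.hq, mul_sub, h.γp]; simp

lemma qq : q * q = q := by rw [h.hq]; simp [mul_sub, sub_mul, h.pp]

lemma fGq : f * G * q = 0 := by
  have : f * G * q = q * G * q - q * G * (γ * G * q) := by rw [h.hf]; noncomm_ring
  rw [this, h.γG, sub_self]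

lemma fq : f * q = q := by
  rw [h.hf, sub_mul, h.qq, mul_assoc, h.γq]; simp

lemma fNq : f * N * q = q := by
  rw [h.hN, mul_sub, sub_mul, h.fGq, mul_one, h.fq, sub_zero]

/-- The projection `p` is injective on the `(-1)`-eigenspace of `G`, because `G` has an invertible
block `W* → W`. -/
lemma eq_zero_of_left {w : R} (hG : G * w = -w) (hp : p * w = 0) : w = 0 := by
  have hq : q * w = w := by rw [h.hq, sub_mul, hp]; simp
  calc w = γ * G * q * w := by rw [h.γG, hq]
    _ = γ * (G * w) := by rw [mul_assoc _ q, hq, mul_assoc]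
    _ = -(γ * p * w) := by rw [hG, h.γp, mul_neg]
    _ = 0 := by rw [mul_assoc, hp]; simp

/-- The transposed form of `eq_zero_of_left`. -/
lemma eq_zero_of_right {w : R} (hG : w * G = -w) (hq : w * q = 0) : w = 0 := by
  have hp : w * p = w := by rw [h.hq, mul_sub, mul_one, sub_eq_zero] at hq; exact hq.symm
  calc w = w * (p * G * γ) := by rw [h.Gγ, hp]
    _ = (w * p) * G * γ := by noncomm_ring
    _ = -(w * (q * γ)) := by rw [hp, hG, h.qγ, neg_mul]
    _ = 0 := by rw [← mul_assoc, hq]; simp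

/-- By `pNe`, the map `N * e` lifts vectors of `W` to the `(-1)`-eigenspace of `G`; both sides take
values there and have the same projection. -/
lemma NeN : N * e * N = N := by
  have key : N * e * N - N = 0 := by
    apply h.eq_zero_of_left
    · have : G * (N * e * N - N) = (G * N) * e * N - G * N := by noncomm_ring
      rw [this, h.GN]; noncomm_ring
    · have : p * (N * e * N - N) = (p * N * e) * N - p * N := by noncomm_ring
      rw [this, h.pNe, sub_self]
  exact sub_eq_zero.1 key

lemma NfN : N * f * N = N := by
  have key : N * f * N - N = 0 := by
    apply h.eq_zero_of_right
    · have : (N * f * N - N) * G = N * f * (N * G) - N * G := by noncomm_ring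
      rw [this, h.NG]; noncomm_ring
    · have : (N * f * N - N) * q = N * (f * N * q) - N * q := by noncomm_ring
      rw [this, h.fNq, sub_self]
  exact sub_eq_zero.1 key

variable {J Jt K : R}

/-- Since `J₁ - J₂ = J₁ * N`, this says that the projection `p` intertwines `J₁` on the
`(-1)`-eigenspace of `G` with `J` on `W`. -/
lemma J_mul_N (hJ : J = p * (J₁ - J₂) * e) : J * N = p * (J₁ - J₂) := by
  rw [hJ, h.sub_eq]
  have : p * (J₁ * N) * e * N = p * J₁ * (N * e * N) := by noncomm_ring
  rw [this, h.NeN, mul_assoc]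

lemma N_mul_Jt (hJt : Jt = -(f * (J₁ - J₂) * q)) : N * Jt = -((J₁ - J₂) * q) := by
  rw [hJt, h.sub_eq, ← h.N_comm]
  have : N * -(f * (N * J₁) * q) = -((N * f * N) * J₁ * q) := by noncomm_ring
  rw [this, h.NfN]

lemma Jp (hJ : J = p * (J₁ - J₂) * e) : J * p = J := by
  rw [hJ, mul_assoc _ e, h.ep]

lemma JJN (hJ : J = p * (J₁ - J₂) * e) : J * J * N = -(p * N) := by
  have h1 := h.J_mul_N hJ
  calc J * J * N = J * p * (J₁ - J₂) := by rw [mul_assoc, h1, mul_assoc]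
    _ = J * N * J₁ := by rw [h.Jp hJ, h.sub_eq, ← h.N_comm, mul_assoc]
    _ = p * N * (J₁ * J₁) := by rw [h1, h.sub_eq, ← h.N_comm]; noncomm_ring
    _ = -(p * N) := by rw [h.sq₁]; simp

/-- The derivative of the commutator of `J₁` and `J₂` along the flow. -/
lemma flow_commutator_eq : (K + J₁ * K * J₁) * J₂ + J₁ * (K + J₂ * K * J₂)
      - (J₂ * (K + J₁ * K * J₁) + (K + J₂ * K * J₂) * J₁) =
    (J₁ - J₂) * K * N - N * K * (J₁ - J₂) := by
  rw [h.hN, h.hG]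
  have e1 : J₂ * (K + J₁ * K * J₁) = J₂ * K + (J₂ * J₁) * K * J₁ := by noncomm_ring
  have e2 : (K + J₂ * K * J₂) * J₁ = K * J₁ + J₂ * K * (J₂ * J₁) := by noncomm_ring
  rw [e1, e2, ← h.comm]
  noncomm_ring

/-- If `K` is of type `(1,1)`, the flow preserves commutation to first order. -/
lemma flow_commutator_eq_zero (hJ : J = p * (J₁ - J₂) * e) (hJt : Jt = -(f * (J₁ - J₂) * q))
    (hpK : p * K = 0) (hKp : K * p = K) (h11 : Jt * K * J = K) :
    (K + J₁ * K * J₁) * J₂ + J₁ * (K + J₂ * K * J₂)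
      - (J₂ * (K + J₁ * K * J₁) + (K + J₂ * K * J₂) * J₁) = 0 := by
  rw [h.flow_commutator_eq, sub_eq_zero]
  have hqK : q * K = K := by rw [h.hq, sub_mul, hpK]; simp
  have e1 : -(Jt * K * N) = K * (J₁ - J₂) := by
    calc -(Jt * K * N) = Jt * (K * p) * -N := by rw [hKp]; noncomm_ring
      _ = Jt * K * (J * J * N) := by rw [h.JJN hJ]; noncomm_ring
      _ = (Jt * K * J) * (J * N) := by noncomm_ring
      _ = (K * p) * (J₁ - J₂) := by rw [h11, h.J_mul_N hJ]; noncomm_ring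
      _ = K * (J₁ - J₂) := by rw [hKp]
  calc (J₁ - J₂) * K * N = -(-((J₁ - J₂) * q) * K * N) := by
        rw [neg_mul, neg_mul, neg_neg, mul_assoc _ q, hqK]
    _ = N * -(Jt * K * N) := by rw [← h.N_mul_Jt hJt]; noncomm_ring
    _ = N * K * (J₁ - J₂) := by rw [e1, mul_assoc]

/-- If the flow preserves commutation to first order, then `K` is of type `(1,1)`. -/
lemma oneOne_of_flow_commutator_eq_zero (hJ : J = p * (J₁ - J₂) * e)
    (hJt : Jt = -(f * (J₁ - J₂) * q)) (hpK : p * K = 0) (hKp : K * p = K)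
    (h0 : (K + J₁ * K * J₁) * J₂ + J₁ * (K + J₂ * K * J₂)
      - (J₂ * (K + J₁ * K * J₁) + (K + J₂ * K * J₂) * J₁) = 0) : Jt * K * J = K := by
  rw [h.flow_commutator_eq, sub_eq_zero] at h0
  have hqK : q * K = K := by rw [h.hq, sub_mul, hpK]; simp
  -- Compressing `h0` by `f` on the left and `e` on the right removes both factors `N`, by `fNq` and
  -- `pNe`.
  have e1 : -(Jt * K) = K * J := by
    calc -(Jt * K) = f * (J₁ - J₂) * (q * K) := by rw [hJt]; noncomm_ring
      _ = f * (J₁ - J₂) * (K * p) := by rw [hqK, hKp]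
      _ = f * ((J₁ - J₂) * K * N) * e := by
          rw [← h.pNe]
          have : f * (J₁ - J₂) * (K * (p * N * e)) = f * (J₁ - J₂) * (K * p) * N * e := by
            noncomm_ring
          rw [this, hKp]; noncomm_ring
      _ = f * (N * K * (J₁ - J₂)) * e := by rw [h0]
      _ = f * N * K * (J₁ - J₂) * e := by noncomm_ring
      _ = f * N * (q * (K * p)) * (J₁ - J₂) * e := by rw [hKp, hqK]
      _ = (f * N * q) * K * J := by rw [hJ]; noncomm_ring
      _ = K * J := by rw [h.fNq, hqK]
  -- `JJN` gives `J² = -1` only after multiplication by `N`; multiplying by `e` turns `p * N` back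
  -- into `p`.
  have e2 : J * J * p = -p := by
    have : J * J * p = J * J * N * e := by
      calc J * J * p = J * (J * p) * N * e := by
            rw [mul_assoc J (J * p) N, mul_assoc J _ e]
            rw [mul_assoc J p N, mul_assoc J (p * N) e, h.pNe, mul_assoc]
        _ = J * J * N * e := by rw [h.Jp hJ]
    rw [this, h.JJN hJ, neg_mul, h.pNe]
  calc Jt * K * J = -(K * (J * J * p)) := by
        rw [mul_assoc J J p, h.Jp hJ, ← neg_neg (Jt * K), e1]; noncomm_ring
    _ = K := by rw [e2, mul_neg, neg_neg, hKp]

end RingPair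

end Ring

/-! ### Relations for pairs that need not commute -/

section RingRel

variable {R S : Type*} [Ring R] [Ring S]

/-- The ring relations satisfied by a positive pair `(J₁, J₂)` that need not commute; `γ` is the
inverse of the block `W* → W` of `-J₁J₂`, and `γ'` is the transpose of `γ`. -/
structure PairRel (J₁ J₂ p γ γ' : R) : Prop where
  sq₁ : J₁ * J₁ = -1
  sq₂ : J₂ * J₂ = -1
  pp : p * p = p
  pγ : p * γ = 0
  γp : γ * p = γ
  pγ' : p * γ' = 0
  γp' : γ' * p = γ'
  γG : γ * -(J₁ * J₂) * (1 - p) = 1 - p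
  Gγ : p * -(J₁ * J₂) * γ = p
  Gγ' : p * -(J₂ * J₁) * γ' = p

/-- The structure `J` on `W`, as an element of the ring. -/
def ringJ (J₁ J₂ p γ : R) : R := p * (J₁ - J₂) * (p - γ * -(J₁ * J₂) * p)

/-- The transpose of `ringJ`. -/
def ringJt (J₁ J₂ p γ' : R) : R :=
  -(((1 - p) - (1 - p) * -(J₂ * J₁) * γ') * (J₁ - J₂) * (1 - p))

/-- The derivative of the commutator of `J₁` and `J₂` along the flow. -/
def flowCommutator (J₁ J₂ K : R) : R :=
  (K + J₁ * K * J₁) * J₂ + J₁ * (K + J₂ * K * J₂)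
    - (J₂ * (K + J₁ * K * J₁) + (K + J₂ * K * J₂) * J₁)

lemma PairRel.map {J₁ J₂ p γ γ' : R} (h : PairRel J₁ J₂ p γ γ') (φ : R →+* S) :
    PairRel (φ J₁) (φ J₂) (φ p) (φ γ) (φ γ') where
  sq₁ := by simpa using congrArg φ h.sq₁
  sq₂ := by simpa using congrArg φ h.sq₂
  pp := by simpa using congrArg φ h.pp
  pγ := by simpa using congrArg φ h.pγ
  γp := by simpa using congrArg φ h.γp
  pγ' := by simpa using congrArg φ h.pγ'
  γp' := by simpa using congrArg φ h.γp'
  γG := by simpa only [map_mul, map_neg, map_sub, map_one] using congrArg φ h.γG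
  Gγ := by simpa only [map_mul, map_neg, map_sub, map_one] using congrArg φ h.Gγ
  Gγ' := by simpa only [map_mul, map_neg, map_sub, map_one] using congrArg φ h.Gγ'

lemma map_ringJ (φ : R →+* S) (J₁ J₂ p γ : R) :
    φ (ringJ J₁ J₂ p γ) = ringJ (φ J₁) (φ J₂) (φ p) (φ γ) := by
  simp only [ringJ, map_mul, map_neg, map_sub]

lemma map_ringJt (φ : R →+* S) (J₁ J₂ p γ : R) :
    φ (ringJt J₁ J₂ p γ) = ringJt (φ J₁) (φ J₂) (φ p) (φ γ) := by
  simp only [ringJt, map_mul, map_neg, map_sub, map_one]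

lemma map_flowCommutator (φ : R →+* S) (J₁ J₂ K : R) :
    φ (flowCommutator J₁ J₂ K) = flowCommutator (φ J₁) (φ J₂) (φ K) := by
  simp only [flowCommutator, map_mul, map_sub, map_add]

/-- For a commuting pair, `γ` is a left inverse and `γ'` a right inverse of the same block of `G`,
so they coincide: the metric is symmetric. -/
lemma PairRel.transpose_eq {J₁ J₂ p γ γ' : R} (h : PairRel J₁ J₂ p γ γ')
    (hc : J₁ * J₂ = J₂ * J₁) : γ' = γ := by
  have e1 : γ = γ * -(J₁ * J₂) * γ' := by
    calc γ = γ * (p * -(J₂ * J₁) * γ') := by rw [h.Gγ', h.γp]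
      _ = γ * p * -(J₁ * J₂) * γ' := by rw [hc]; noncomm_ring
      _ = γ * -(J₁ * J₂) * γ' := by rw [h.γp]
  have e2 : γ' = γ * -(J₁ * J₂) * γ' := by
    calc γ' = (1 - p) * γ' := by rw [sub_mul, h.pγ']; simp
      _ = γ * -(J₁ * J₂) * ((1 - p) * γ') := by rw [← mul_assoc, h.γG]
      _ = γ * -(J₁ * J₂) * γ' := by rw [sub_mul, h.pγ']; simp
  rw [e2, ← e1]

/-- Working in an arbitrary ring allows two uses: in the endomorphisms of `W ⊕ W*`, and in the
quotient ring of `flowCommutator_bound`. -/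
lemma PairRel.oneOne_iff {J₁ J₂ p γ γ' K : R} (h : PairRel J₁ J₂ p γ γ')
    (hc : J₁ * J₂ = J₂ * J₁) (hpK : p * K = 0) (hKp : K * p = K) :
    ringJt J₁ J₂ p γ' * K * ringJ J₁ J₂ p γ = K ↔ flowCommutator J₁ J₂ K = 0 := by
  have hγ := h.transpose_eq hc
  subst hγ
  have hr : RingPair J₁ J₂ p (1 - p) γ' (p - γ' * -(J₁ * J₂) * p)
      ((1 - p) - (1 - p) * -(J₁ * J₂) * γ') (-(J₁ * J₂)) (1 - -(J₁ * J₂)) :=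
    { sq₁ := h.sq₁, sq₂ := h.sq₂, comm := hc, hq := rfl, pp := h.pp, pγ := h.pγ, γp := h.γp,
      hG := rfl, γG := h.γG, Gγ := h.Gγ, he := rfl, hf := rfl, hN := rfl }
  have hJt : ringJt J₁ J₂ p γ' =
      -(((1 - p) - (1 - p) * -(J₁ * J₂) * γ') * (J₁ - J₂) * (1 - p)) := by rw [ringJt, hc]
  exact ⟨fun h11 => hr.flow_commutator_eq_zero rfl hJt hpK hKp h11,
    fun h0 => hr.oneOne_of_flow_commutator_eq_zero rfl hJt hpK hKp h0⟩

end RingRel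

/-! ### Adjoints for the neutral inner product -/

section Adjoint

variable {E : Type*} [NormedAddCommGroup E] [NormedSpace ℝ E]

lemma pairing_comm (v w : Gen E) : pairing v w = pairing w v := by
  simp [pairing, add_comm]

lemma pairing_neg_right (v w : Gen E) : pairing v (-w) = -pairing v w := by
  simp [pairing]; ring

lemma pairing_neg_left (v w : Gen E) : pairing (-v) w = -pairing v w := by
  simp [pairing]; ring

lemma pairing_sub_right (v w w' : Gen E) : pairing v (w - w') = pairing v w - pairing v w' := by
  simp [pairing]; ring

lemma pairing_sub_left (v w w' : Gen E) : pairing (w - w') v = pairing w v - pairing w' v := by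
  simp [pairing]; ring

lemma eq_of_pairing_left {w w' : Gen E} (h : ∀ v, pairing v w = pairing v w') : w = w' := by
  refine Prod.ext ?_ ?_
  · rw [← sub_eq_zero]
    refine SeparatingDual.eq_zero_of_forall_dual_eq_zero (R := ℝ) fun ξ => ?_
    have := h (0, ξ)
    simp [pairing] at this
    simp [this]
  · ext X
    simpa [pairing] using h (X, 0)

instance : Ring (Gen E →L[ℝ] Gen E) := ContinuousLinearMap.ring

instance : Semigroup (Gen E →L[ℝ] Gen E) := inferInstance

instance : Distrib (Gen E →L[ℝ] Gen E) := inferInstance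

/-- `B` is the adjoint of `A` for the neutral inner product. -/
def IsAdj (A B : Gen E →L[ℝ] Gen E) : Prop := ∀ v w, pairing (A v) w = pairing v (B w)

namespace IsAdj

variable {A B A' B' : Gen E →L[ℝ] Gen E}

lemma symm (h : IsAdj A B) : IsAdj B A := fun v w => by
  rw [pairing_comm, ← h, pairing_comm]

lemma mul (h : IsAdj A B) (h' : IsAdj A' B') : IsAdj (A * A') (B' * B) := fun v w => by
  rw [mul_apply_eq_comp, mul_apply_eq_comp, h, h']

lemma neg (h : IsAdj A B) : IsAdj (-A) (-B) := fun v w => by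
  rw [_root_.neg_apply, _root_.neg_apply, pairing_neg_left, pairing_neg_right, h]

lemma sub (h : IsAdj A B) (h' : IsAdj A' B') : IsAdj (A - A') (B - B') := fun v w => by
  rw [_root_.sub_apply, _root_.sub_apply, pairing_sub_left, pairing_sub_right, h, h']

lemma unique (h : IsAdj A B) (h' : IsAdj A B') : B = B' :=
  ContinuousLinearMap.ext fun w => eq_of_pairing_left fun v => by rw [← h, h']

end IsAdj

lemma isAdj_of_orth {J : Gen E →L[ℝ] Gen E} (hsq : ∀ v, J (J v) = -v)
    (ho : ∀ v w, pairing (J v) (J w) = pairing v w) : IsAdj J (-J) := fun v w => by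
  have := ho v (J w)
  rw [hsq, pairing_neg_right] at this
  rw [_root_.neg_apply, pairing_neg_right, ← this, neg_neg]

/-- The projection to `W`, as an endomorphism of `W ⊕ W*`. -/
def projT : Gen E →L[ℝ] Gen E :=
  ContinuousLinearMap.inl ℝ E (E →L[ℝ] ℝ) ∘L ContinuousLinearMap.fst ℝ E (E →L[ℝ] ℝ)

/-- A bilinear form on `W`, as an endomorphism of `W ⊕ W*`. -/
def formOp (b : E →L[ℝ] (E →L[ℝ] ℝ)) : Gen E →L[ℝ] Gen E :=
  ContinuousLinearMap.inr ℝ E (E →L[ℝ] ℝ) ∘L b ∘L ContinuousLinearMap.fst ℝ E (E →L[ℝ] ℝ)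

@[simp] lemma projT_apply (v : Gen E) : projT v = (v.1, 0) := rfl

@[simp] lemma formOp_apply (b : E →L[ℝ] (E →L[ℝ] ℝ)) (v : Gen E) : formOp b v = (0, b v.1) := rfl

lemma projT_mul_formOp (b : E →L[ℝ] (E →L[ℝ] ℝ)) : projT * formOp b = 0 := rfl

lemma formOp_mul_projT (b : E →L[ℝ] (E →L[ℝ] ℝ)) : formOp b * projT = formOp b := rfl

lemma isAdj_projT : IsAdj (projT : Gen E →L[ℝ] Gen E) (1 - projT) := fun v w => by
  simp [pairing]

lemma isAdj_formOp (b : E →L[ℝ] (E →L[ℝ] ℝ)) : IsAdj (formOp b) (formOp b.flip) := fun v w => by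
  simp [pairing]

/-- The identity part of `e^K = 1 + K` drops out of the commutator, and `-K J² = K`. -/
lemma Phi_eq [FiniteDimensional ℝ E] (K : E [⋀^Fin 2]→L[ℝ] ℝ) {J : Gen E →L[ℝ] Gen E}
    (hsq : ∀ v, J (J v) = -v) : Phi K J = formOp (flat K) + J * formOp (flat K) * J := by
  have he : ∀ v, expB (flat K) v = v + formOp (flat K) v := fun v => by
    refine Prod.ext ?_ ?_ <;> simp [expB]
  refine ContinuousLinearMap.ext fun v => ?_
  simp only [Phi, _root_.sub_apply, _root_.add_apply, ContinuousLinearMap.comp_apply,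
    mul_apply_eq_comp, he, map_add, hsq, map_neg]
  abel

/-- A positive pair of orthogonal complex structures on `W ⊕ W*`, possibly not commuting. -/
structure IsFiberPair (J₁ J₂ : Gen E →L[ℝ] Gen E) : Prop where
  sq₁ : ∀ v, J₁ (J₁ v) = -v
  sq₂ : ∀ v, J₂ (J₂ v) = -v
  orth₁ : ∀ v w, pairing (J₁ v) (J₁ w) = pairing v w
  orth₂ : ∀ v w, pairing (J₂ v) (J₂ w) = pairing v w
  pos : IsPositivePair J₁ J₂

lemma cometric_pos {J₁ J₂ : Gen E →L[ℝ] Gen E} (h : IsPositivePair J₁ J₂) {ξ : E →L[ℝ] ℝ}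
    (hξ : ξ ≠ 0) : 0 < ξ (cometric J₁ J₂ ξ) := by
  have := h (0, ξ) (by simpa using hξ)
  simp only [pairing, map_zero, zero_add] at this
  have e : ξ (cometric J₁ J₂ ξ) = ξ (genMetric J₁ J₂ (0, ξ)).1 := rfl
  rw [e]; linarith

variable [FiniteDimensional ℝ E]

/-- Positivity on covectors makes the kernel trivial, and dimensions agree. Neither symmetry of the
block nor commutation of the pair is needed. -/
lemma cometric_bijective {J₁ J₂ : Gen E →L[ℝ] Gen E} (h : IsPositivePair J₁ J₂) :
    Function.Bijective (cometric J₁ J₂) := by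
  have hinj : Function.Injective (cometric J₁ J₂) := by
    refine (injective_iff_map_eq_zero _).2 fun ξ hξ => ?_
    by_contra h0
    simpa [hξ] using cometric_pos h h0
  refine ⟨hinj, ?_⟩
  have hd : Module.finrank ℝ (E →L[ℝ] ℝ) = Module.finrank ℝ E := by
    rw [← (LinearMap.toContinuousLinearMap (𝕜 := ℝ) (E := E) (F' := ℝ)).finrank_eq]
    exact Subspace.dual_finrank_eq
  exact (LinearMap.injective_iff_surjective_of_finrank_eq_finrank
    (f := (cometric J₁ J₂ : (E →L[ℝ] ℝ) →ₗ[ℝ] E)) hd).1 hinj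

lemma cometric_isInvertible {J₁ J₂ : Gen E →L[ℝ] Gen E} (h : IsPositivePair J₁ J₂) :
    (cometric J₁ J₂).IsInvertible :=
  ⟨(LinearEquiv.ofBijective (cometric J₁ J₂ : (E →L[ℝ] ℝ) →ₗ[ℝ] E)
    (cometric_bijective h)).toContinuousLinearEquiv, rfl⟩

/-- The metric determined by a positive pair, as an endomorphism of `W ⊕ W*`. -/
def metricOp (J₁ J₂ : Gen E →L[ℝ] Gen E) : Gen E →L[ℝ] Gen E := formOp (cometric J₁ J₂).inverse

/-- The transpose of `metricOp`. -/
def metricOpT (J₁ J₂ : Gen E →L[ℝ] Gen E) : Gen E →L[ℝ] Gen E :=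
  formOp (cometric J₁ J₂).inverse.flip

lemma IsFiberPair.pairRel {J₁ J₂ : Gen E →L[ℝ] Gen E} (h : IsFiberPair J₁ J₂) :
    PairRel J₁ J₂ projT (metricOp J₁ J₂) (metricOpT J₁ J₂) := by
  have hi := cometric_isInvertible h.pos
  have γG : metricOp J₁ J₂ * -(J₁ * J₂) * (1 - projT) = 1 - projT := by
    refine ContinuousLinearMap.ext fun v => ?_
    have e1 : (1 - projT : Gen E →L[ℝ] Gen E) v = (0, v.2) := by
      refine Prod.ext ?_ ?_ <;> simp
    have e2 : (metricOp J₁ J₂ * -(J₁ * J₂) * (1 - projT) : Gen E →L[ℝ] Gen E) v =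
        (0, (cometric J₁ J₂).inverse (cometric J₁ J₂ ((1 - projT : Gen E →L[ℝ] Gen E) v).2)) := by
      rw [mul_apply_eq_comp, e1]; rfl
    rw [e2, e1, hi.inverse_apply_eq.2 rfl]
  -- Without commutation, `-(J₁ * J₂)` has adjoint `-(J₂ * J₁)`. Taking adjoints in `γG` therefore
  -- produces the relation `Gγ'` for the transposed metric.
  have adj : IsAdj (metricOp J₁ J₂ * -(J₁ * J₂) * (1 - projT))
      (projT * (-(J₂ * J₁) * metricOpT J₁ J₂)) := by
    refine IsAdj.mul ?_ isAdj_projT.symm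
    refine (isAdj_formOp _).mul ?_
    have e : J₂ * J₁ = -J₂ * -J₁ := ContinuousLinearMap.ext fun v => by simp
    rw [e]
    exact ((isAdj_of_orth h.sq₁ h.orth₁).mul (isAdj_of_orth h.sq₂ h.orth₂)).neg
  exact
  { sq₁ := ContinuousLinearMap.ext fun v => by simp [h.sq₁]
    sq₂ := ContinuousLinearMap.ext fun v => by simp [h.sq₂]
    pp := rfl
    pγ := rfl
    γp := rfl
    pγ' := rfl
    γp' := rfl
    γG := γG
    Gγ := by
      refine ContinuousLinearMap.ext fun v => ?_
      have : (projT * -(J₁ * J₂) * metricOp J₁ J₂ : Gen E →L[ℝ] Gen E) v =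
        (cometric J₁ J₂ ((cometric J₁ J₂).inverse v.1), 0) := rfl
      rw [this, hi.self_apply_inverse]
      rfl
    Gγ' := by
      rw [γG] at adj
      rw [mul_assoc]
      exact adj.unique isAdj_projT.symm }

omit [FiniteDimensional ℝ E] in
lemma ringJ_apply (J₁ J₂ : Gen E →L[ℝ] Gen E) (v : Gen E) :
    ringJ J₁ J₂ projT (metricOp J₁ J₂) v = (gualtieriJ J₁ J₂ v.1, 0) := by
  have e1 : (projT - metricOp J₁ J₂ * -(J₁ * J₂) * projT : Gen E →L[ℝ] Gen E) v =
      expB (gualtieriB J₁ J₂) (v.1, 0) := by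
    refine Prod.ext ?_ ?_
    · simp [expB, metricOp]
    · simp [expB, metricOp, gualtieriB, blockA, genMetric]
  rw [ringJ, mul_apply_eq_comp, e1]
  refine Prod.ext ?_ rfl
  simp [gualtieriJ, expB]

omit [FiniteDimensional ℝ E] in
lemma IsFiberPair.isAdj_ringJ {J₁ J₂ : Gen E →L[ℝ] Gen E} (h : IsFiberPair J₁ J₂) :
    IsAdj (ringJ J₁ J₂ projT (metricOp J₁ J₂)) (ringJt J₁ J₂ projT (metricOpT J₁ J₂)) := by
  have a₁ := isAdj_of_orth h.sq₁ h.orth₁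
  have a₂ := isAdj_of_orth h.sq₂ h.orth₂
  have := ((isAdj_projT (E := E)).mul (a₁.sub a₂)).mul
    (isAdj_projT.sub (((isAdj_formOp (cometric J₁ J₂).inverse).mul (a₁.mul a₂).neg).mul
      isAdj_projT))
  convert this using 1
  · rfl
  · unfold ringJt metricOpT
    noncomm_ring

/-- `ringJt` is the adjoint of `ringJ`, so pairing `v` with the product on `w` evaluates `K` on `J
w.1` and `J v.1`; the pairing is nondegenerate. -/
lemma IsFiberPair.isOneOne_iff {J₁ J₂ : Gen E →L[ℝ] Gen E} (h : IsFiberPair J₁ J₂)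
    (K : E [⋀^Fin 2]→L[ℝ] ℝ) :
    IsOneOne (gualtieriJ J₁ J₂) K ↔
      ringJt J₁ J₂ projT (metricOpT J₁ J₂) * formOp (flat K) * ringJ J₁ J₂ projT (metricOp J₁ J₂)
        = formOp (flat K) := by
  have key : ∀ v w, pairing v ((ringJt J₁ J₂ projT (metricOpT J₁ J₂) * formOp (flat K) *
      ringJ J₁ J₂ projT (metricOp J₁ J₂)) w) =
      1 / 2 * K ![gualtieriJ J₁ J₂ w.1, gualtieriJ J₁ J₂ v.1] := by
    intro v w
    rw [mul_assoc, mul_apply_eq_comp, ← h.isAdj_ringJ, ringJ_apply,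
      mul_apply_eq_comp, ringJ_apply]
    simp [pairing, flat_apply]
  constructor
  · intro h11
    refine ContinuousLinearMap.ext fun w => eq_of_pairing_left fun v => ?_
    rw [key, h11]
    simp [pairing, flat_apply]
  · intro he X Y
    have := key (Y, 0) (X, 0)
    rw [he] at this
    simp [pairing, flat_apply] at this
    exact this.symm

end Adjoint

/-! ### Uniqueness for linear differential inequalities on an interval -/

section Gronwall

variable {F : Type*} [NormedAddCommGroup F] [NormedSpace ℝ F]

lemma eq_zero_of_deriv_bound_right {a b c : ℝ} {w w' : ℝ → F}
    (hw : ∀ t ∈ Icc a b, HasDerivWithinAt w (w' t) (Icc a b) t)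
    (hb : ∀ t ∈ Icc a b, ‖w' t‖ ≤ c * ‖w t‖) (ha : w a = 0) : ∀ t ∈ Icc a b, w t = 0 := by
  intro t ht
  have := norm_le_gronwallBound_of_norm_deriv_right_le (f := w) (f' := w') (δ := 0) (K := c)
    (ε := 0) (a := a) (b := b) (fun t ht => (hw t ht).continuousWithinAt)
    (fun x hx => ((hw x (Ico_subset_Icc_self hx)).mono
      (Icc_subset_Icc_left hx.1)).mono_of_mem_nhdsWithin (Icc_mem_nhdsGE hx.2))
    (by simp [ha]) (fun x hx => by simpa using hb x (Ico_subset_Icc_self hx)) t ht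
  simpa [gronwallBound_ε0_δ0] using this

/-- A function on an interval that satisfies `‖w'‖ ≤ c ‖w‖` locally vanishes if it vanishes
somewhere. -/
lemma eq_zero_of_deriv_bound {T : Set ℝ} (hT : T.OrdConnected) {w w' : ℝ → F}
    (hw : ∀ t ∈ T, HasDerivWithinAt w (w' t) T t)
    (hb : ∀ a b, Icc a b ⊆ T → ∃ c, ∀ t ∈ Icc a b, ‖w' t‖ ≤ c * ‖w t‖)
    {t₀ : ℝ} (ht₀ : t₀ ∈ T) (h0 : w t₀ = 0) : ∀ t ∈ T, w t = 0 := by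
  intro t ht
  rcases le_total t₀ t with h | h
  · have hs : Icc t₀ t ⊆ T := hT.out ht₀ ht
    obtain ⟨c, hc⟩ := hb _ _ hs
    exact eq_zero_of_deriv_bound_right (fun s hs' => (hw s (hs hs')).mono hs) hc h0 t
      (right_mem_Icc.2 h)
  · have hs : Icc t t₀ ⊆ T := hT.out ht ht₀
    obtain ⟨c, hc⟩ := hb _ _ hs
    have hm : ∀ s ∈ Icc (-t₀) (-t), -s ∈ Icc t t₀ := fun s hs' =>
      ⟨by linarith [hs'.2], by linarith [hs'.1]⟩
    -- Times before `t₀` are handled by the reflection `s ↦ -s`.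
    have := eq_zero_of_deriv_bound_right (a := -t₀) (b := -t) (c := c) (w := fun s => w (-s))
      (w' := fun s => -w' (-s))
      (fun s hs' => by
        have := HasDerivWithinAt.scomp s ((hw _ (hs (hm s hs'))).mono hs)
          (hasDerivAt_neg s).hasDerivWithinAt (s := Icc (-t₀) (-t)) hm
        simpa [Function.comp_def] using this)
      (fun s hs' => by simpa using hc _ (hm s hs')) (by simpa using h0) (-t)
      ⟨by linarith, le_rfl⟩
    simpa using this

end Gronwall

/-! ### Functions that are bounded by a given function -/

section Small

variable {X A : Type*} [TopologicalSpace X] [CompactSpace X] [NormedRing A]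

/-- The congruence of continuous functions modulo functions bounded by a multiple of `C`. -/
def smallCon (C : C(X, A)) : RingCon C(X, A) where
  r f g := ∃ c : ℝ, ∀ x, ‖f x - g x‖ ≤ c * ‖C x‖
  iseqv :=
    { refl := fun f => ⟨0, fun x => by simp⟩
      symm := fun ⟨c, hc⟩ => ⟨c, fun x => by rw [norm_sub_rev]; exact hc x⟩
      trans := fun {f g h} ⟨c, hc⟩ ⟨d, hd⟩ => ⟨c + d, fun x => by
        rw [add_mul]
        exact (norm_sub_le_norm_sub_add_norm_sub _ (g x) _).trans (add_le_add (hc x) (hd x))⟩ }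
  add' := fun {f f' g g'} ⟨c, hc⟩ ⟨d, hd⟩ => ⟨c + d, fun x => by
    have : (f + g) x - (f' + g') x = (f x - f' x) + (g x - g' x) := by
      simp only [ContinuousMap.add_apply]; abel
    rw [this, add_mul]
    exact (norm_add_le _ _).trans (add_le_add (hc x) (hd x))⟩
  -- Compactness makes `g` and `f'` bounded, so the error of a product is still linear in `‖C x‖`.
  mul' := fun {f f' g g'} ⟨c, hc⟩ ⟨d, hd⟩ => ⟨c * ‖g‖ + ‖f'‖ * d, fun x => by
    have : (f * g) x - (f' * g') x = (f x - f' x) * g x + f' x * (g x - g' x) := by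
      simp only [ContinuousMap.mul_apply]; noncomm_ring
    rw [this]
    have h1 : ‖(f x - f' x) * g x‖ ≤ (c * ‖C x‖) * ‖g‖ :=
      (norm_mul_le _ _).trans (mul_le_mul (hc x) (g.norm_coe_le_norm x) (norm_nonneg _)
        ((norm_nonneg _).trans (hc x)))
    have h2 : ‖f' x * (g x - g' x)‖ ≤ ‖f'‖ * (d * ‖C x‖) :=
      (norm_mul_le _ _).trans (mul_le_mul (f'.norm_coe_le_norm x) (hd x) (norm_nonneg _)
        (norm_nonneg _))
    calc _ ≤ _ := norm_add_le _ _
      _ ≤ _ := add_le_add h1 h2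
      _ = _ := by ring⟩

/-- If `K` is of type `(1,1)`, the derivative of the commutator of `J₁` and `J₂` along the flow is
bounded by the commutator. -/
lemma flowCommutator_bound {J₁ J₂ p γ γ' K : C(X, A)}
    (h : ∀ x, PairRel (J₁ x) (J₂ x) (p x) (γ x) (γ' x))
    (hpK : ∀ x, p x * K x = 0) (hKp : ∀ x, K x * p x = K x)
    (h11 : ∀ x, ringJt (J₁ x) (J₂ x) (p x) (γ' x) * K x * ringJ (J₁ x) (J₂ x) (p x) (γ x) = K x) :
    ∃ c : ℝ, ∀ x, ‖flowCommutator (J₁ x) (J₂ x) (K x)‖ ≤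
      c * ‖J₁ x * J₂ x - J₂ x * J₁ x‖ := by
  have hrel : PairRel J₁ J₂ p γ γ' :=
    { sq₁ := ContinuousMap.ext fun x => (h x).sq₁
      sq₂ := ContinuousMap.ext fun x => (h x).sq₂
      pp := ContinuousMap.ext fun x => (h x).pp
      pγ := ContinuousMap.ext fun x => (h x).pγ
      γp := ContinuousMap.ext fun x => (h x).γp
      pγ' := ContinuousMap.ext fun x => (h x).pγ'
      γp' := ContinuousMap.ext fun x => (h x).γp'
      γG := ContinuousMap.ext fun x => (h x).γG
      Gγ := ContinuousMap.ext fun x => (h x).Gγ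
      Gγ' := ContinuousMap.ext fun x => (h x).Gγ' }
  -- Modulo multiples of the norm of the commutator, `J₁` and `J₂` commute, so the algebra of
  -- commuting pairs applies in the quotient. Vanishing of the flow commutator there is the desired
  -- estimate.
  let r := smallCon (J₁ * J₂ - J₂ * J₁)
  have hc : r.mk' J₁ * r.mk' J₂ = r.mk' J₂ * r.mk' J₁ := by
    rw [← map_mul, ← map_mul]
    exact (RingCon.eq r).2 ⟨1, fun x => by simp⟩
  have h11' : ringJt J₁ J₂ p γ' * K * ringJ J₁ J₂ p γ = K := ContinuousMap.ext h11
  have hpK' : p * K = 0 := ContinuousMap.ext hpK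
  have hKp' : K * p = K := ContinuousMap.ext hKp
  have key := ((hrel.map r.mk').oneOne_iff (K := r.mk' K) hc
    (by rw [← map_mul, hpK', map_zero]) (by rw [← map_mul, hKp'])).1
    (by rw [← map_ringJ, ← map_ringJt, ← map_mul, ← map_mul, h11'])
  rw [← map_flowCommutator, ← map_zero r.mk'] at key
  obtain ⟨c, hc⟩ := (RingCon.eq r).1 key
  refine ⟨c, fun x => ?_⟩
  have := hc x
  rw [ContinuousMap.zero_apply, sub_zero] at this
  exact this

end Small

/-! ### The flow in a normed algebra -/

section AlgebraFlow

lemma continuousOn_of_hasDerivWithinAt {F : Type*} [NormedAddCommGroup F] [NormedSpace ℝ F]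
    {T : Set ℝ} {f f' : ℝ → F} (h : ∀ t ∈ T, HasDerivWithinAt f (f' t) T t) : ContinuousOn f T :=
  fun t ht => (h t ht).continuousWithinAt

lemma clm_comp_hasDerivWithinAt {F G : Type*} [NormedAddCommGroup F] [NormedSpace ℝ F]
    [NormedAddCommGroup G] [NormedSpace ℝ G] (L : F →L[ℝ] G) {T : Set ℝ} {f : ℝ → F} {f' : F}
    {t : ℝ} (h : HasDerivWithinAt f f' T t) : HasDerivWithinAt (fun t => L (f t)) (L f') T t :=
  L.hasFDerivAt.comp_hasDerivWithinAt t h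

lemma uniqueDiffWithinAt_of_ordConnected {T : Set ℝ} (hT : T.OrdConnected) (hT' : T.Nontrivial)
    {t : ℝ} (ht : t ∈ T) : UniqueDiffWithinAt ℝ T t := by
  refine uniqueDiffOn_convex hT.convex ?_ t ht
  obtain ⟨a, ha, b, hb, hab⟩ := hT'.exists_lt
  exact (nonempty_Ioo.2 hab).mono
    (interior_maximal (Ioo_subset_Icc_self.trans (hT.out ha hb)) isOpen_Ioo)

variable {A : Type*} [NormedRing A] [NormedAlgebra ℝ A] {T : Set ℝ} {J₁ J₂ K : ℝ → A}

lemma hasDerivWithinAt_commutator {t : ℝ}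
    (hd₁ : HasDerivWithinAt J₁ (K t + J₁ t * K t * J₁ t) T t)
    (hd₂ : HasDerivWithinAt J₂ (K t + J₂ t * K t * J₂ t) T t) :
    HasDerivWithinAt (fun s => J₁ s * J₂ s - J₂ s * J₁ s)
      (flowCommutator (J₁ t) (J₂ t) (K t)) T t := by
  refine ((hd₁.mul hd₂).sub (hd₂.mul hd₁)).congr_deriv ?_
  unfold flowCommutator
  rw [add_comm (J₂ t * _)]

/-- The commutator is identically zero on `T`, and derivatives within a nondegenerate interval are
unique. -/
lemma flowCommutator_eq_zero (hT : T.OrdConnected) (hT' : T.Nontrivial)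
    (hd₁ : ∀ t ∈ T, HasDerivWithinAt J₁ (K t + J₁ t * K t * J₁ t) T t)
    (hd₂ : ∀ t ∈ T, HasDerivWithinAt J₂ (K t + J₂ t * K t * J₂ t) T t)
    (hc : ∀ t ∈ T, J₁ t * J₂ t = J₂ t * J₁ t) {t : ℝ} (ht : t ∈ T) :
    flowCommutator (J₁ t) (J₂ t) (K t) = 0 := by
  have h1 := hasDerivWithinAt_commutator (hd₁ t ht) (hd₂ t ht)
  have h2 : HasDerivWithinAt (fun s => J₁ s * J₂ s - J₂ s * J₁ s) 0 T t :=
    (hasDerivWithinAt_const t T 0).congr (fun s hs => sub_eq_zero.2 (hc s hs))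
      (sub_eq_zero.2 (hc t ht))
  exact (uniqueDiffWithinAt_of_ordConnected hT hT' ht).eq_deriv _ h1 h2

/-- Gronwall's inequality for the commutator, with the constant on each compact subinterval supplied
by `flowCommutator_bound`. -/
lemma commute_of_ringJt_mul (hT : T.OrdConnected) {t₀ : ℝ} (ht₀ : t₀ ∈ T) {p : A} {γ γ' : ℝ → A}
    (hd₁ : ∀ t ∈ T, HasDerivWithinAt J₁ (K t + J₁ t * K t * J₁ t) T t)
    (hd₂ : ∀ t ∈ T, HasDerivWithinAt J₂ (K t + J₂ t * K t * J₂ t) T t)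
    (hK : ContinuousOn K T) (hγ : ContinuousOn γ T) (hγ' : ContinuousOn γ' T)
    (hrel : ∀ t ∈ T, PairRel (J₁ t) (J₂ t) p (γ t) (γ' t))
    (hpK : ∀ t, p * K t = 0) (hKp : ∀ t, K t * p = K t)
    (h11 : ∀ t ∈ T, ringJt (J₁ t) (J₂ t) p (γ' t) * K t * ringJ (J₁ t) (J₂ t) p (γ t) = K t)
    (h0 : J₁ t₀ * J₂ t₀ = J₂ t₀ * J₁ t₀) : ∀ t ∈ T, J₁ t * J₂ t = J₂ t * J₁ t := by
  have key := eq_zero_of_deriv_bound (t₀ := t₀) hT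
    (fun t ht => hasDerivWithinAt_commutator (hd₁ t ht) (hd₂ t ht))
    (fun a b hab => by
      have hres : ∀ {f : ℝ → A}, ContinuousOn f T → Continuous ((Icc a b).domRestrict f) :=
        fun hf => continuousOn_iff_continuous_domRestrict.1 (hf.mono hab)
      obtain ⟨c, hc⟩ := flowCommutator_bound (X := Icc a b)
        (J₁ := ⟨_, hres (continuousOn_of_hasDerivWithinAt hd₁)⟩)
        (J₂ := ⟨_, hres (continuousOn_of_hasDerivWithinAt hd₂)⟩) (p := ContinuousMap.const _ p)
        (γ := ⟨_, hres hγ⟩) (γ' := ⟨_, hres hγ'⟩) (K := ⟨_, hres hK⟩)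
        (fun x => hrel x (hab x.2)) (fun x => hpK x) (fun x => hKp x)
        (fun x => h11 x (hab x.2))
      exact ⟨c, fun t ht => hc ⟨t, ht⟩⟩) ht₀ (sub_eq_zero.2 h0)
  exact fun t ht => sub_eq_zero.1 (key t ht)

/-- The defect `w = J (a + β b) + (b - β a)` of the eigenvector equation satisfies the linear
equation `w' = J κ w`, because `κ β = 0`. It therefore vanishes at all times if it does at one. -/
lemma eigen_transport_aux {V : Type*} [NormedAddCommGroup V] [NormedSpace ℝ V]
    (hT : T.OrdConnected) {J κ β : ℝ → (V →L[ℝ] V)} (hκ : ContinuousOn κ T)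
    (hd : ∀ t ∈ T, HasDerivWithinAt J (κ t + J t * κ t * J t) T t)
    (hβ : ∀ t ∈ T, HasDerivWithinAt β (κ t) T t) (hκβ : ∀ t, κ t * β t = 0)
    (a b : V) {s t : ℝ} (hs : s ∈ T) (ht : t ∈ T)
    (h : J s (a + β s b) + (b - β s a) = 0) : J t (a + β t b) + (b - β t a) = 0 := by
  have hβ' : ∀ t ∈ T, ∀ v, HasDerivWithinAt (fun t => β t v) (κ t v) T t := fun t ht v => by
    simpa using (hβ t ht).clm_apply (hasDerivWithinAt_const t T v)
  have hκβ' : ∀ t v, κ t (β t v) = 0 := fun t v => congrArg (fun f => f v) (hκβ t)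
  refine eq_zero_of_deriv_bound (w := fun t => J t (a + β t b) + (b - β t a))
    (w' := fun t => J t (κ t (J t (a + β t b) + (b - β t a)))) hT ?_ ?_ hs h t ht
  · intro t ht
    refine (((hd t ht).clm_apply ((hβ' t ht b).const_add a)).add
      ((hβ' t ht a).const_sub b)).congr_deriv ?_
    simp only [_root_.add_apply, mul_apply_eq_comp, map_add, map_sub, hκβ', map_zero]
    abel
  · intro α β hαβ
    obtain ⟨c, hc⟩ := isCompact_Icc.exists_bound_of_continuousOn
      (((continuousOn_of_hasDerivWithinAt hd).mul hκ).mono hαβ)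
    exact ⟨c, fun t ht => ContinuousLinearMap.le_of_opNorm_le (J t * κ t) (hc t ht) _⟩

end AlgebraFlow

/-! ### The flow on a fixed vector space -/

section FiberFlow

variable {E : Type*} [NormedAddCommGroup E] [NormedSpace ℝ E]

/-- `formOp` as a continuous linear map. -/
def formOpL : (E →L[ℝ] (E →L[ℝ] ℝ)) →L[ℝ] (Gen E →L[ℝ] Gen E) :=
  (ContinuousLinearMap.compL ℝ (Gen E) (E →L[ℝ] ℝ) (Gen E)
      (ContinuousLinearMap.inr ℝ E (E →L[ℝ] ℝ))) ∘L
    ((ContinuousLinearMap.compL ℝ (Gen E) E (E →L[ℝ] ℝ)).flip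
      (ContinuousLinearMap.fst ℝ E (E →L[ℝ] ℝ)))

variable [FiniteDimensional ℝ E]

lemma flat_add (K K' : E [⋀^Fin 2]→L[ℝ] ℝ) : flat (K + K') = flat K + flat K' := by
  refine ContinuousLinearMap.ext fun X => ContinuousLinearMap.ext fun Y => ?_
  simp [flat_apply]

lemma flat_smul (c : ℝ) (K : E [⋀^Fin 2]→L[ℝ] ℝ) : flat (c • K) = c • flat K := by
  refine ContinuousLinearMap.ext fun X => ContinuousLinearMap.ext fun Y => ?_
  simp [flat_apply]

lemma norm_flat_le (K : E [⋀^Fin 2]→L[ℝ] ℝ) : ‖flat K‖ ≤ 1 * ‖K‖ := by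
  refine ContinuousLinearMap.opNorm_le_bound₂ _ (by positivity) fun X Y => ?_
  have := K.le_opNorm ![X, Y]
  simpa [Fin.prod_univ_two, flat_apply, mul_assoc] using this

variable (E) in
/-- `flat` as a continuous linear map. -/
def flatL : (E [⋀^Fin 2]→L[ℝ] ℝ) →L[ℝ] (E →L[ℝ] (E →L[ℝ] ℝ)) :=
  LinearMap.mkContinuous (F := E →L[ℝ] (E →L[ℝ] ℝ))
    { toFun := fun K => flat K
      map_add' := by intro K K'; exact flat_add K K'
      map_smul' := by intro c K; exact flat_smul c K } 1
    (by intro K; exact norm_flat_le K)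

lemma flatL_apply (K : E [⋀^Fin 2]→L[ℝ] ℝ) : flatL E K = flat K := rfl

variable {T : Set ℝ} {J₁ J₂ : ℝ → (Gen E →L[ℝ] Gen E)} {K : ℝ → E [⋀^Fin 2]→L[ℝ] ℝ}

lemma continuousOn_formOp_flat (hK : ContinuousOn K T) :
    ContinuousOn (fun t => formOp (flat (K t))) T :=
  (formOpL.continuous.comp (flatL E).continuous).comp_continuousOn hK

lemma continuousOn_inverse_cometric (h₁ : ContinuousOn J₁ T) (h₂ : ContinuousOn J₂ T)
    (hpos : ∀ t ∈ T, IsPositivePair (J₁ t) (J₂ t)) :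
    ContinuousOn (fun t => (cometric (J₁ t) (J₂ t)).inverse) T := by
  have hc : ContinuousOn (fun t => cometric (J₁ t) (J₂ t)) T := by
    unfold cometric genMetric
    exact continuousOn_const.clm_comp ((h₁.clm_comp h₂).neg.clm_comp continuousOn_const)
  intro t ht
  obtain ⟨e, he⟩ := cometric_isInvertible (hpos t ht)
  have : ContinuousAt ContinuousLinearMap.inverse (cometric (J₁ t) (J₂ t)) := by
    rw [← he]
    exact (contDiffAt_map_inverse (n := 0) e).continuousAt
  exact this.comp_continuousWithinAt (f := fun t => cometric (J₁ t) (J₂ t)) (hc t ht)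

lemma hasDerivWithinAt_of_Phi {J : ℝ → (Gen E →L[ℝ] Gen E)}
    (hsq : ∀ t ∈ T, ∀ v, J t (J t v) = -v)
    (hd : ∀ t ∈ T, HasDerivWithinAt J (Phi (K t) (J t)) T t) : ∀ t ∈ T, HasDerivWithinAt J
      (formOp (flat (K t)) + J t * formOp (flat (K t)) * J t) T t := fun t ht => by
  rw [← Phi_eq _ (hsq t ht)]
  exact hd t ht

/-- Along the flow of a `(1,1)`-form, positive pairs remain commuting. -/
theorem commute_of_isOneOne (hT : T.OrdConnected) {t₀ : ℝ} (ht₀ : t₀ ∈ T)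
    (hJ : ∀ t ∈ T, IsFiberPair (J₁ t) (J₂ t)) (hK : ContinuousOn K T)
    (hd₁ : ∀ t ∈ T, HasDerivWithinAt J₁ (Phi (K t) (J₁ t)) T t)
    (hd₂ : ∀ t ∈ T, HasDerivWithinAt J₂ (Phi (K t) (J₂ t)) T t)
    (h11 : ∀ t ∈ T, IsOneOne (gualtieriJ (J₁ t) (J₂ t)) (K t))
    (h0 : J₁ t₀ * J₂ t₀ = J₂ t₀ * J₁ t₀) : ∀ t ∈ T, J₁ t * J₂ t = J₂ t * J₁ t := by
  have hd₁' := hasDerivWithinAt_of_Phi (fun t ht => (hJ t ht).sq₁) hd₁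
  have hd₂' := hasDerivWithinAt_of_Phi (fun t ht => (hJ t ht).sq₂) hd₂
  have hg := continuousOn_inverse_cometric
    (continuousOn_of_hasDerivWithinAt (F := Gen E →L[ℝ] Gen E) hd₁)
    (continuousOn_of_hasDerivWithinAt (F := Gen E →L[ℝ] Gen E) hd₂) fun t ht => (hJ t ht).pos
  exact commute_of_ringJt_mul (A := Gen E →L[ℝ] Gen E) hT ht₀ hd₁' hd₂'
    (continuousOn_formOp_flat hK)
    (formOpL.continuous.comp_continuousOn hg)
    ((formOpL.continuous.comp
      (ContinuousLinearMap.flipₗᵢ ℝ E E ℝ).continuous).comp_continuousOn hg)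
    (fun t ht => (hJ t ht).pairRel) (fun t => projT_mul_formOp _) (fun t => formOp_mul_projT _)
    (fun t ht => ((hJ t ht).isOneOne_iff _).1 (h11 t ht)) h0

/-- If positive pairs remain commuting along the flow of `K`, then `K` is of type `(1,1)`. -/
theorem isOneOne_of_commute (hT : T.OrdConnected) (hT' : T.Nontrivial)
    (hJ : ∀ t ∈ T, IsFiberPair (J₁ t) (J₂ t))
    (hd₁ : ∀ t ∈ T, HasDerivWithinAt J₁ (Phi (K t) (J₁ t)) T t)
    (hd₂ : ∀ t ∈ T, HasDerivWithinAt J₂ (Phi (K t) (J₂ t)) T t)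
    (hc : ∀ t ∈ T, J₁ t * J₂ t = J₂ t * J₁ t) :
    ∀ t ∈ T, IsOneOne (gualtieriJ (J₁ t) (J₂ t)) (K t) := by
  intro t ht
  have h0 := flowCommutator_eq_zero (A := Gen E →L[ℝ] Gen E) hT hT'
    (hasDerivWithinAt_of_Phi (fun t ht => (hJ t ht).sq₁) hd₁)
    (hasDerivWithinAt_of_Phi (fun t ht => (hJ t ht).sq₂) hd₂) hc ht
  exact ((hJ t ht).isOneOne_iff _).2
    (((hJ t ht).pairRel.oneOne_iff (hc t ht) (projT_mul_formOp _) (formOp_mul_projT _)).2 h0)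

/-- With `B = ∫ K`, the transformation `e^{-√-1 B}` maps the `√-1`-eigenspace of `J` at one time to
the `√-1`-eigenspace at any other time. -/
theorem eigen_transport (hT : T.OrdConnected) {J : ℝ → (Gen E →L[ℝ] Gen E)}
    (hsq : ∀ t ∈ T, ∀ v, J t (J t v) = -v) (hK : ContinuousOn K T)
    (hd : ∀ t ∈ T, HasDerivWithinAt J (Phi (K t) (J t)) T t) {B : ℝ → E [⋀^Fin 2]→L[ℝ] ℝ}
    (hB : ∀ t ∈ T, HasDerivWithinAt B (K t) T t) (a b : Gen E) {s t : ℝ} (hs : s ∈ T) (ht : t ∈ T)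
    (h : J s (a + formOp (flat (B s)) b) + (b - formOp (flat (B s)) a) = 0) :
    J t (a + formOp (flat (B t)) b) + (b - formOp (flat (B t)) a) = 0 :=
  eigen_transport_aux (V := Gen E) (β := fun t => formOp (flat (B t))) hT
    (continuousOn_formOp_flat hK) (hasDerivWithinAt_of_Phi hsq hd)
    (fun t ht => clm_comp_hasDerivWithinAt (F := E →L[ℝ] (E →L[ℝ] ℝ))
      (G := Gen E →L[ℝ] Gen E) formOpL
      (clm_comp_hasDerivWithinAt (F := E [⋀^Fin 2]→L[ℝ] ℝ) (flatL E) (hB t ht)))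
    (fun t => ContinuousLinearMap.ext fun v => by simp) a b hs ht h

end FiberFlow

/-! ### Three-forms and commuting pairs -/

section ThreeForm

variable {W : Type*} [AddCommGroup W] [Module ℝ W] [TopologicalSpace W]

/-- The covector `i_Y i_X H = H(X, Y, ·)`. -/
def contract₃ (H : W [⋀^Fin 3]→L[ℝ] ℝ) (X Y : W) : W →L[ℝ] ℝ :=
  H.toContinuousLinearMap ![X, Y, 0] 2

lemma contract₃_apply (H : W [⋀^Fin 3]→L[ℝ] ℝ) (X Y Z : W) :
    contract₃ H X Y Z = H ![X, Y, Z] := by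
  have h : Function.update ![X, Y, 0] 2 Z = ![X, Y, Z] := by
    ext i; fin_cases i <;> simp
  change H (Function.update ![X, Y, 0] 2 Z) = H ![X, Y, Z]
  rw [h]

lemma map_swap_right (H : W [⋀^Fin 3]→L[ℝ] ℝ) (X Y Z : W) : H ![X, Z, Y] = -H ![X, Y, Z] := by
  have := H.map_swap ![X, Y, Z] (i := 1) (j := 2) (by decide)
  refine Eq.trans ?_ this
  change H _ = H _
  congr 1
  ext i; fin_cases i <;> rfl

lemma map_swap_left (H : W [⋀^Fin 3]→L[ℝ] ℝ) (X Y Z : W) : H ![Y, X, Z] = -H ![X, Y, Z] := by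
  have := H.map_swap ![X, Y, Z] (i := 0) (j := 1) (by decide)
  refine Eq.trans ?_ this
  change H _ = H _
  congr 1
  ext i; fin_cases i <;> rfl

variable {E : Type*} [NormedAddCommGroup E] [NormedSpace ℝ E] [FiniteDimensional ℝ E]

/-- The `(+1)`-eigenspace of `G = -J₁J₂` is where `J₁` and `J₂` agree. It projects onto `E`, since
it contains `ξ + G ξ` for every covector `ξ` and the block `ξ ↦ (G ξ).1` is onto. -/
lemma IsFiberPair.exists_fixed {J₁ J₂ : Gen E →L[ℝ] Gen E} (h : IsFiberPair J₁ J₂)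
    (hc : ∀ v, J₁ (J₂ v) = J₂ (J₁ v)) (X : E) : ∃ u : Gen E, J₁ u = J₂ u ∧ u.1 = X := by
  obtain ⟨ξ, hξ⟩ := (cometric_bijective h.pos).2 X
  refine ⟨(0, ξ) + genMetric J₁ J₂ (0, ξ), ?_, ?_⟩
  · have e1 : J₁ (genMetric J₁ J₂ (0, ξ)) = J₂ (0, ξ) := by
      simp [genMetric, h.sq₁]
    have e2 : J₂ (genMetric J₁ J₂ (0, ξ)) = J₁ (0, ξ) := by
      simp [genMetric, hc, h.sq₂]
    rw [map_add, map_add, e1, e2, add_comm]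
  · rw [Prod.fst_add, zero_add]
    exact hξ

/-- A 3-form whose contractions with the `√-1`-eigenvectors of both structures of a commuting
positive pair are again `√-1`-eigenvectors is zero. -/
lemma IsFiberPair.threeForm_eq_zero {J₁ J₂ : Gen E →L[ℝ] Gen E} (h : IsFiberPair J₁ J₂)
    (hc : ∀ v, J₁ (J₂ v) = J₂ (J₁ v)) (f : E [⋀^Fin 3]→L[ℝ] ℝ)
    (h₁ : ∀ u w, J₁ (0, contract₃ f u.1 w.1 - contract₃ f (J₁ u).1 (J₁ w).1) =
      (0, contract₃ f u.1 (J₁ w).1 + contract₃ f (J₁ u).1 w.1))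
    (h₂ : ∀ u w, J₂ (0, contract₃ f u.1 w.1 - contract₃ f (J₂ u).1 (J₂ w).1) =
      (0, contract₃ f u.1 (J₂ w).1 + contract₃ f (J₂ u).1 w.1)) : f = 0 := by
  have key : ∀ u w, J₁ u = J₂ u → J₁ w = J₂ w → ∀ Z,
      f ![u.1, w.1, Z] = f ![(J₁ u).1, (J₁ w).1, Z] := by
    intro u w hu hw Z
    set η := contract₃ f u.1 w.1 - contract₃ f (J₁ u).1 (J₁ w).1 with hη
    -- For such `u` and `w` the right-hand sides of `h₁` and `h₂` coincide, so the covector `η` lies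
    -- in the `(+1)`-eigenspace of `G`. The pairing is positive definite there, while covectors are
    -- null.
    have e : J₁ (0, η) = J₂ (0, η) := by
      have := h₂ u w
      rw [← hu, ← hw] at this
      rw [h₁, this]
    have h0 : η = 0 := by
      by_contra hne
      have hp := h.pos (0, η) (by simpa using hne)
      have : genMetric J₁ J₂ (0, η) = (0, η) := by
        simp [genMetric, ← e, h.sq₁]
      rw [this] at hp
      simp [pairing] at hp
    have := congrArg (fun ξ => ξ Z) h0
    simp only [hη, _root_.sub_apply, contract₃_apply, _root_.zero_apply] at this
    linarith
  refine ContinuousAlternatingMap.ext fun m => ?_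
  have hm : m = ![m 0, m 1, m 2] := by ext i; fin_cases i <;> rfl
  rw [hm]
  obtain ⟨u, hu, hu'⟩ := h.exists_fixed hc (m 0)
  obtain ⟨v, hv, hv'⟩ := h.exists_fixed hc (m 1)
  obtain ⟨w, hw, hw'⟩ := h.exists_fixed hc (m 2)
  rw [← hu', ← hv', ← hw']
  have hJ : ∀ {u}, J₁ u = J₂ u → J₁ (J₁ u) = J₂ (J₁ u) := fun {u} hu => by
    rw [← hc, ← hu]
  -- Write `I` for `J₁` carried to `E` from the `(+1)`-eigenspace, and `X`, `Y`, `Z` for the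
  -- projections of `u`, `v`, `w`. Then `f(X,Y,Z) = f(IX,IY,Z) = -f(IX,Y,IZ) = f(IX,IZ,Y) = f(X,Z,Y)
  -- = -f(X,Y,Z)`.
  have e1 := key u v hu hv w.1
  have e2 := key (J₁ v) w (hJ hv) hw (J₁ u).1
  have e3 := key u w hu hw v.1
  simp only [h.sq₁, Prod.fst_neg] at e2
  have r : ∀ X Y Z : E, f ![X, Y, Z] = f ![Y, Z, X] := fun X Y Z => by
    rw [map_swap_right f Y X Z, map_swap_left f X Y Z, neg_neg]
  have n : ∀ Y Z X : E, f ![-Y, Z, X] = -f ![Y, Z, X] := fun Y Z X => by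
    simpa using f.cons_smul ![Z, X] (-1) Y
  rw [← r (J₁ u).1, n, ← r (J₁ u).1, map_swap_right f (J₁ u).1 (J₁ w).1 v.1, neg_neg] at e2
  rw [map_swap_right f u.1 v.1 w.1] at e3
  change _ = (0 : ℝ)
  linarith

end ThreeForm

/-! ### Integrals that depend on a parameter -/

section Parametric

universe u

variable {E : Type u} [NormedAddCommGroup E] [NormedSpace ℝ E]
  {F : Type u} [NormedAddCommGroup F] [NormedSpace ℝ F]

/-- The fundamental theorem of calculus on an interval that may contain endpoints, where the
derivative is one-sided. -/
lemma hasDerivWithinAt_integral [CompleteSpace F] {T : Set ℝ} (hT : T.OrdConnected) {a : ℝ}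
    (ha : a ∈ T) {f : ℝ → F} (hf : ContinuousOn f T) {t : ℝ} (ht : t ∈ T) :
    HasDerivWithinAt (fun t => ∫ s in a..t, f s) (f t) T t := by
  have hint : ∀ {b c}, b ∈ T → c ∈ T → IntervalIntegrable f MeasureTheory.volume b c :=
    fun hb hc => (hf.mono (hT.uIcc_subset hb hc)).intervalIntegrable
  rw [hasDerivWithinAt_iff_isLittleO, Asymptotics.isLittleO_iff]
  intro ε hε
  have hc := Metric.continuousWithinAt_iff.1 (hf t ht) ε hε
  obtain ⟨δ, hδ, hδ'⟩ := hc
  filter_upwards [self_mem_nhdsWithin, mem_nhdsWithin_of_mem_nhds (Metric.ball_mem_nhds t hδ)]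
    with s hs hsδ
  have e : (∫ r in a..s, f r) - (∫ r in a..t, f r) - (s - t) • f t
      = ∫ r in t..s, (f r - f t) := by
    rw [intervalIntegral.integral_interval_sub_left (hint ha hs) (hint ha ht),
      intervalIntegral.integral_sub (hint ht hs) intervalIntegrable_const,
      intervalIntegral.integral_const]
  rw [e, Real.norm_eq_abs]
  refine intervalIntegral.norm_integral_le_of_norm_le_const fun r hr => ?_
  have hr' := uIoc_subset_uIcc hr
  have hrT : r ∈ T := hT.uIcc_subset ht hs hr'
  have hd : dist r t < δ := by
    rw [dist_comm]
    rw [Metric.mem_ball, dist_comm] at hsδ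
    exact (Real.dist_left_le_of_mem_uIcc hr').trans_lt hsδ
  rw [← dist_eq_norm]
  exact (hδ' hrT hd).le

variable {T : Set ℝ} (hT : T.OrdConnected) (hT' : T.Nontrivial) {U : Set E} (hU : IsOpen U)

/-- The derivative in the second variable. -/
def partialSnd (T : Set ℝ) (U : Set E) (f : ℝ × E → F) (p : ℝ × E) : E →L[ℝ] F :=
  fderivWithin ℝ f (T ×ˢ U) p ∘L ContinuousLinearMap.inr ℝ ℝ E

include hT hT' hU

lemma uniqueDiffOn_prod : UniqueDiffOn ℝ (T ×ˢ U) :=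
  UniqueDiffOn.prod (fun _ ht => uniqueDiffWithinAt_of_ordConnected hT hT' ht) hU.uniqueDiffOn

lemma contDiffOn_partialSnd {f : ℝ × E → F} (hf : ContDiffOn ℝ ∞ f (T ×ˢ U)) :
    ContDiffOn ℝ ∞ (partialSnd T U f) (T ×ˢ U) :=
  (hf.fderivWithin (uniqueDiffOn_prod hT hT' hU) (by simp)).clm_comp contDiffOn_const

omit hT hT' in
lemma hasFDerivAt_partialSnd {f : ℝ × E → F} (hf : ContDiffOn ℝ ∞ f (T ×ˢ U)) {s : ℝ} {y : E}
    (hs : s ∈ T) (hy : y ∈ U) : HasFDerivAt (fun z => f (s, z)) (partialSnd T U f (s, y)) y := by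
  have h1 : HasFDerivWithinAt f (fderivWithin ℝ f (T ×ˢ U) (s, y)) (T ×ˢ U) (s, y) :=
    ((hf.differentiableOn (by simp)) _ ⟨hs, hy⟩).hasFDerivWithinAt
  have h2 : HasFDerivWithinAt (fun z => f (s, z)) (partialSnd T U f (s, y)) U y :=
    h1.comp y (hasFDerivAt_prodMk_right (𝕜 := ℝ) s y).hasFDerivWithinAt fun z hz => ⟨hs, hz⟩
  exact h2.hasFDerivAt (hU.mem_nhds hy)

variable [FiniteDimensional ℝ E]

lemma hasFDerivAt_integral {f : ℝ × E → F} (hf : ContDiffOn ℝ ∞ f (T ×ˢ U)) {a b : ℝ}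
    (ha : a ∈ T) (hb : b ∈ T) {y : E} (hy : y ∈ U) :
    HasFDerivAt (fun y => ∫ s in a..b, f (s, y)) (∫ s in a..b, partialSnd T U f (s, y)) y := by
  have hab : uIcc a b ⊆ T := hT.uIcc_subset ha hb
  obtain ⟨ε, hε, hball⟩ := Metric.nhds_basis_closedBall.mem_iff.1 (hU.mem_nhds hy)
  have : ProperSpace E := FiniteDimensional.proper ℝ E
  have hf' := (contDiffOn_partialSnd hT hT' hU hf).continuousOn
  -- The bound on this compact set is the constant dominating function for differentiation under the
  -- integral.
  obtain ⟨C, hC⟩ := (isCompact_uIcc.prod (isCompact_closedBall y ε)).exists_bound_of_continuousOn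
    (hf'.mono (prod_mono hab hball))
  have slice : ∀ {G : Type u} [NormedAddCommGroup G] {g : ℝ × E → G}, ContinuousOn g (T ×ˢ U) →
      ∀ z ∈ U, ContinuousOn (fun s => g (s, z)) (uIcc a b) := fun hg z hz =>
    hg.comp (continuous_id.prodMk continuous_const).continuousOn fun s hs => ⟨hab hs, hz⟩
  refine intervalIntegral.hasFDerivAt_integral_of_dominated_of_fderiv_le (𝕜 := ℝ)
    (F := fun y s => f (s, y)) (F' := fun y s => partialSnd T U f (s, y)) (bound := fun _ => C)
    (Metric.closedBall_mem_nhds y hε) ?_ ?_ ?_ ?_ ?_ ?_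
  · filter_upwards [hU.mem_nhds hy] with z hz
    exact ((slice hf.continuousOn z hz).mono uIoc_subset_uIcc).aestronglyMeasurable
      measurableSet_uIoc
  · exact (slice hf.continuousOn y hy).intervalIntegrable
  · exact ((slice hf' y hy).mono uIoc_subset_uIcc).aestronglyMeasurable measurableSet_uIoc
  · exact MeasureTheory.ae_of_all _ fun s hs z hz => hC (s, z) ⟨uIoc_subset_uIcc hs, hz⟩
  · exact intervalIntegrable_const
  · exact MeasureTheory.ae_of_all _ fun s hs z hz =>
      hasFDerivAt_partialSnd hU hf (hab (uIoc_subset_uIcc hs)) (hball hz)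

/-- Induction on the order, since the derivative is again an integral of this kind. Its values lie
in `E →L[ℝ] F`, so the target space is quantified inside the statement, in the same universe as `E`.
-/
lemma contDiffOn_integral_nat (n : ℕ) {a b : ℝ} (ha : a ∈ T) (hb : b ∈ T) :
    ∀ {F : Type u} [NormedAddCommGroup F] [NormedSpace ℝ F] {f : ℝ × E → F},
      ContDiffOn ℝ ∞ f (T ×ˢ U) → ContDiffOn ℝ n (fun y => ∫ s in a..b, f (s, y)) U := by
  induction n with
  | zero =>
    intro F _ _ f hf
    exact contDiffOn_zero.2 fun y hy =>
      (hasFDerivAt_integral hT hT' hU hf ha hb hy).continuousAt.continuousWithinAt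
  | succ n ih =>
    intro F _ _ f hf
    have h := fun y hy => hasFDerivAt_integral hT hT' hU hf ha hb (y := y) hy
    rw [Nat.cast_succ]
    refine (contDiffOn_succ_iff_fderiv_of_isOpen hU).2
      ⟨fun y hy => (h y hy).differentiableAt.differentiableWithinAt,
        fun hn => absurd hn (by simp), ?_⟩
    exact (ih (contDiffOn_partialSnd hT hT' hU hf)).congr fun y hy => (h y hy).fderiv

lemma contDiffOn_integral {a b : ℝ} (ha : a ∈ T) (hb : b ∈ T) {f : ℝ × E → F}
    (hf : ContDiffOn ℝ ∞ f (T ×ˢ U)) : ContDiffOn ℝ ∞ (fun y => ∫ s in a..b, f (s, y)) U :=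
  contDiffOn_infty.2 fun n => contDiffOn_integral_nat hT hT' hU n ha hb hf

end Parametric

/-! ### Sections of `T ⊕ T*` in charts -/

section Charts

variable {E : Type*} [NormedAddCommGroup E] [NormedSpace ℝ E]
  {M : Type*} [TopologicalSpace M] [ChartedSpace E M]

/-- The coordinate expression of a vector field in the chart at `x₀`. -/
def vecInChart (X : (x : M) → TangentSpace 𝓘(ℝ, E) x) (x₀ : M) (y : E) : E :=
  mfderiv 𝓘(ℝ, E) 𝓘(ℝ, E) (extChartAt 𝓘(ℝ, E) x₀) ((extChartAt 𝓘(ℝ, E) x₀).symm y)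
    (X ((extChartAt 𝓘(ℝ, E) x₀).symm y))

/-- The coordinate expression of a section of `T*` in the chart at `x₀`. -/
def covecInChart (η : (x : M) → (TangentSpace 𝓘(ℝ, E) x →L[ℝ] ℝ)) (x₀ : M) (y : E) : E →L[ℝ] ℝ :=
  (η ((extChartAt 𝓘(ℝ, E) x₀).symm y)) ∘L
    (mfderiv 𝓘(ℝ, E) 𝓘(ℝ, E) (extChartAt 𝓘(ℝ, E) x₀).symm y)

/-- The coordinate expression of a section of `T ⊕ T*` in the chart at `x₀`. -/
def fieldInChart (u : GenField E M) (x₀ : M) (y : E) : Gen E :=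
  (vecInChart (fun x => (u x).1) x₀ y, covecInChart (fun x => (u x).2) x₀ y)

lemma fieldInChart_add (u v : GenField E M) (x₀ : M) (y : E) :
    fieldInChart (fun x => u x + v x) x₀ y = fieldInChart u x₀ y + fieldInChart v x₀ y := by
  refine Prod.ext (map_add _ _ _) ?_
  exact ContinuousLinearMap.add_comp _ _ _

lemma fieldInChart_neg (u : GenField E M) (x₀ : M) (y : E) :
    fieldInChart (fun x => -u x) x₀ y = -fieldInChart u x₀ y := by
  refine Prod.ext (map_neg _ _) ?_
  exact ContinuousLinearMap.neg_comp _ _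

lemma extChartAt_symm_self (x : M) :
    (extChartAt 𝓘(ℝ, E) x).symm (extChartAt 𝓘(ℝ, E) x x) = x := extChartAt_to_inv x

lemma fieldInChart_sub (u v : GenField E M) (x₀ : M) (y : E) :
    fieldInChart (fun x => u x - v x) x₀ y = fieldInChart u x₀ y - fieldInChart v x₀ y := by
  refine Prod.ext (map_sub _ _ _) ?_
  exact ContinuousLinearMap.sub_comp _ _ _

variable [IsManifold 𝓘(ℝ, E) ∞ M]

instance instIsManifoldOne : IsManifold 𝓘(ℝ, E) 1 M := IsManifold.of_le (n := ∞) (by simp)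

lemma mfderiv_symm_mfderiv (x₀ : M) {y : E} (hy : y ∈ (extChartAt 𝓘(ℝ, E) x₀).target)
    (v : TangentSpace 𝓘(ℝ, E) ((extChartAt 𝓘(ℝ, E) x₀).symm y)) :
    mfderiv 𝓘(ℝ, E) 𝓘(ℝ, E) (extChartAt 𝓘(ℝ, E) x₀).symm y
      (mfderiv 𝓘(ℝ, E) 𝓘(ℝ, E) (extChartAt 𝓘(ℝ, E) x₀) ((extChartAt 𝓘(ℝ, E) x₀).symm y) v) = v := by
  have := mfderivWithin_extChartAt_symm_comp_mfderiv_extChartAt (I := 𝓘(ℝ, E)) hy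
  rw [ModelWithCorners.range_eq_univ, mfderivWithin_univ] at this
  exact congrArg (fun f => f v) this

lemma mfderiv_mfderiv_symm (x₀ : M) {y : E} (hy : y ∈ (extChartAt 𝓘(ℝ, E) x₀).target) (v : E) :
    mfderiv 𝓘(ℝ, E) 𝓘(ℝ, E) (extChartAt 𝓘(ℝ, E) x₀) ((extChartAt 𝓘(ℝ, E) x₀).symm y)
      (mfderiv 𝓘(ℝ, E) 𝓘(ℝ, E) (extChartAt 𝓘(ℝ, E) x₀).symm y v) = v := by
  have := mfderiv_extChartAt_comp_mfderivWithin_extChartAt_symm (I := 𝓘(ℝ, E)) hy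
  rw [ModelWithCorners.range_eq_univ, mfderivWithin_univ] at this
  exact congrArg (fun f => f v) this

/-- The tangent space at `x` is identified with `E` by the chart at `x`. Evaluating brackets and
exterior derivatives at the centre of that chart thus removes all transition maps. -/
lemma mfderiv_symm_self (x : M) : mfderiv 𝓘(ℝ, E) 𝓘(ℝ, E) (extChartAt 𝓘(ℝ, E) x).symm
    (extChartAt 𝓘(ℝ, E) x x) = ContinuousLinearMap.id ℝ E := by
  have := mfderivWithin_range_extChartAt_symm (I := 𝓘(ℝ, E)) (x := x)
  rwa [ModelWithCorners.range_eq_univ, mfderivWithin_univ] at this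

lemma vecInChart_self (X : (x : M) → TangentSpace 𝓘(ℝ, E) x) (x : M) :
    vecInChart X x (extChartAt 𝓘(ℝ, E) x x) = X x := by
  unfold vecInChart
  rw [extChartAt_symm_self, mfderiv_extChartAt_self]
  rfl

lemma covecInChart_self (η : (x : M) → (TangentSpace 𝓘(ℝ, E) x →L[ℝ] ℝ)) (x : M) :
    covecInChart η x (extChartAt 𝓘(ℝ, E) x x) = η x := by
  unfold covecInChart
  rw [mfderiv_symm_self, extChartAt_symm_self]
  rfl

lemma fieldInChart_self (u : GenField E M) (x : M) :
    fieldInChart u x (extChartAt 𝓘(ℝ, E) x x) = u x :=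
  Prod.ext (vecInChart_self (fun x => (u x).1) x) (covecInChart_self (fun x => (u x).2) x)

lemma formInChart_self {k : ℕ} (α : Form E M k) (x : M) :
    formInChart α x (extChartAt 𝓘(ℝ, E) x x) = α x := by
  unfold formInChart
  rw [mfderiv_symm_self, extChartAt_symm_self]
  rfl

lemma trivializationAt_genBundle_baseSet (x₀ : M) :
    (trivializationAt (E × (E →L[ℝ] ℝ)) (GenBundle E M) x₀).baseSet = (chartAt E x₀).source := by
  have : (trivializationAt (E × (E →L[ℝ] ℝ)) (GenBundle E M) x₀).baseSet =
      (trivializationAt E (TangentSpace 𝓘(ℝ, E) : M → Type _) x₀).baseSet ∩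
        (trivializationAt (E →L[ℝ] ℝ)
          (fun x : M => TangentSpace 𝓘(ℝ, E) x →L[ℝ] ℝ) x₀).baseSet := rfl
  rw [this, hom_trivializationAt_baseSet]
  simp

/-- Bundle trivializations are given by the differential of the chart on `T` and by precomposition
with the differential of its inverse on `T*`. This turns smoothness of sections into smoothness of
coordinate expressions. -/
lemma trivializationAt_genBundle_apply (x₀ x : M) (hx : x ∈ (chartAt E x₀).source)
    (u : GenField E M) :
    (trivializationAt (E × (E →L[ℝ] ℝ)) (GenBundle E M) x₀ ⟨x, u x⟩).2 =
      fieldInChart u x₀ (extChartAt 𝓘(ℝ, E) x₀ x) := by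
  have hxx : (extChartAt 𝓘(ℝ, E) x₀).symm (extChartAt 𝓘(ℝ, E) x₀ x) = x :=
    (extChartAt 𝓘(ℝ, E) x₀).left_inv (by rwa [extChartAt_source])
  unfold fieldInChart vecInChart covecInChart
  rw [hxx]
  refine Prod.ext ?_ ?_
  · have h1 := TangentBundle.continuousLinearMapAt_trivializationAt (I := 𝓘(ℝ, E)) hx
    have h2 := (trivializationAt E (TangentSpace 𝓘(ℝ, E) : M → Type _)
      x₀).continuousLinearMapAt_apply_of_mem (R := ℝ) (b := x) (by simpa using hx) (u x).1
    rw [h1] at h2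
    exact h2.symm
  · have h1 := TangentBundle.symmL_trivializationAt (I := 𝓘(ℝ, E)) hx
    simp only [ModelWithCorners.range_eq_univ, mfderivWithin_univ] at h1
    rw [← h1]
    change (trivializationAt (E →L[ℝ] ℝ)
      (fun x : M => TangentSpace 𝓘(ℝ, E) x →L[ℝ] ℝ) x₀ ⟨x, (u x).2⟩).2 = _
    rw [hom_trivializationAt_apply]
    simp [ContinuousLinearMap.inCoordinates]

/-- A section of `T ⊕ T*` is smooth if and only if its coordinate expressions are. -/
lemma isSmoothField_iff [FiniteDimensional ℝ E] (u : GenField E M) :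
    IsSmoothField u ↔
      ∀ x₀, ContDiffOn ℝ ∞ (fieldInChart u x₀) (extChartAt 𝓘(ℝ, E) x₀).target := by
  have h1 : IsSmoothField u ↔ ∀ x₀ : M, ContMDiffOn 𝓘(ℝ, E) (𝓘(ℝ, E).prod 𝓘(ℝ, E × (E →L[ℝ] ℝ))) ∞
      (fun x => TotalSpace.mk' (E × (E →L[ℝ] ℝ)) (E := GenBundle E M) x (u x))
      (chartAt E x₀).source := by
    refine ⟨fun h x₀ => h.contMDiffOn, fun h x₀ => ?_⟩
    exact (h x₀).contMDiffAt ((chartAt E x₀).open_source.mem_nhds (mem_chart_source E x₀))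
  rw [h1]
  refine forall_congr' fun x₀ => ?_
  rw [Trivialization.contMDiffOn_section_iff
    (trivializationAt (E × (E →L[ℝ] ℝ)) (GenBundle E M) x₀) (chartAt E x₀).open_source
    (trivializationAt_genBundle_baseSet x₀).ge,
    contMDiffOn_congr fun x hx => trivializationAt_genBundle_apply x₀ x hx u]
  constructor
  · intro h
    refine ContMDiffOn.contDiffOn ?_
    refine (h.comp (contMDiffOn_extChartAt_symm x₀) fun y hy => ?_).congr fun y hy => ?_
    · rw [← extChartAt_source 𝓘(ℝ, E)]
      exact (extChartAt 𝓘(ℝ, E) x₀).map_target hy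
    · simp only [Function.comp_apply]
      rw [(extChartAt 𝓘(ℝ, E) x₀).right_inv hy]
  · intro h
    refine h.contMDiffOn.comp contMDiffOn_extChartAt fun x hx => ?_
    exact (extChartAt 𝓘(ℝ, E) x₀).map_source (by rwa [extChartAt_source])

lemma IsSmoothEndo.apply {J : GenEndo E M} (hJ : IsSmoothEndo J) {u : GenField E M}
    (hu : IsSmoothField u) : IsSmoothField (fun x => J x (u x)) :=
  ContMDiff.clm_bundle_apply (E₁ := GenBundle E M) (E₂ := GenBundle E M) hJ hu

variable [FiniteDimensional ℝ E]

lemma IsSmoothField.add {u v : GenField E M} (hu : IsSmoothField u) (hv : IsSmoothField v) :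
    IsSmoothField (fun x => u x + v x) := by
  rw [isSmoothField_iff] at *
  exact fun x₀ => ((hu x₀).add (hv x₀)).congr fun y _ => fieldInChart_add u v x₀ y

lemma IsSmoothField.neg {u : GenField E M} (hu : IsSmoothField u) :
    IsSmoothField (fun x => -u x) := by
  rw [isSmoothField_iff] at *
  exact fun x₀ => (hu x₀).neg.congr fun y _ => fieldInChart_neg u x₀ y

lemma IsSmoothField.differentiableAt {u : GenField E M} (hu : IsSmoothField u) (x : M) :
    DifferentiableAt ℝ (fieldInChart u x) (extChartAt 𝓘(ℝ, E) x x) :=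
  (((isSmoothField_iff u).1 hu x).differentiableOn (by simp)).differentiableAt
    ((isOpen_extChartAt_target x).mem_nhds (mem_extChartAt_target x))

/-- A section constant in the local trivialization, cut off by a bump function supported in the
chart domain. -/
lemma exists_isSmoothField [T2Space M] (x : M) (v : Gen (TangentSpace 𝓘(ℝ, E) x)) :
    ∃ u : GenField E M, IsSmoothField u ∧ u x = v := by
  let e := trivializationAt (E × (E →L[ℝ] ℝ)) (GenBundle E M) x
  have he : e.baseSet = (chartAt E x).source := trivializationAt_genBundle_baseSet x
  have hx : x ∈ e.baseSet := by rw [he]; exact mem_chart_source E x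
  let w := (e ⟨x, v⟩).2
  let f : SmoothBumpFunction 𝓘(ℝ, E) x := Classical.arbitrary _
  refine ⟨fun y => f y • e.symm y w, ?_, ?_⟩
  · refine ContMDiffOn.smul_section_of_tsupport (u := e.baseSet) (V := GenBundle E M)
      (ψ := f) (s := fun y => e.symm y w)
      f.contMDiff.contMDiffOn e.open_baseSet ?_ ?_
    · rw [he]
      exact f.tsupport_subset_chartAt_source
    · refine (e.contMDiffOn_section_baseSet_iff).2 ?_
      refine (contMDiffOn_const (c := w)).congr fun y hy => ?_
      rw [e.apply_mk_symm hy]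
  · have : e.symm x w = v := e.symm_apply_apply_mk hx v
    simp only [f.eq_one, this, one_smul]

end Charts

/-! ### The Courant bracket in charts -/

section CourantInChart

variable {E : Type*} [NormedAddCommGroup E] [NormedSpace ℝ E]
  {M : Type*} [TopologicalSpace M] [ChartedSpace E M]

lemma inverse_apply_of_leftRightInverse {A B : E →L[ℝ] E} (h : ∀ v, A (B v) = v)
    (h' : ∀ v, B (A v) = v) (v : E) : A.inverse v = B v := by
  rw [ContinuousLinearMap.inverse_eq (g := B) (ContinuousLinearMap.ext h)
    (ContinuousLinearMap.ext h')]

lemma extD_eq [IsManifold 𝓘(ℝ, E) ∞ M] {k : ℕ} (α : Form E M k) (x : M) :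
    extD α x = extDeriv (formInChart α x) (extChartAt 𝓘(ℝ, E) x x) := by
  unfold extD
  rw [mfderiv_extChartAt_self]
  rfl

lemma extDeriv_one_apply (α : E → E [⋀^Fin 1]→L[ℝ] ℝ) (y X Y : E) :
    extDeriv α y ![X, Y] = fderiv ℝ α y X ![Y] - fderiv ℝ α y Y ![X] := by
  rw [extDeriv, ContinuousAlternatingMap.alternatizeUncurryFin_apply, Fin.sum_univ_two]
  have e0 : Fin.removeNth 0 ![X, Y] = ![Y] := by ext i; fin_cases i; rfl
  have e1 : Fin.removeNth 1 ![X, Y] = ![X] := by ext i; fin_cases i; rfl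
  rw [e0, e1]
  simp [sub_eq_add_neg]

lemma alternatizeUncurryFin_two_apply (b : E →L[ℝ] E [⋀^Fin 2]→L[ℝ] ℝ) (X Y Z : E) :
    ContinuousAlternatingMap.alternatizeUncurryFin b ![X, Y, Z] =
      b X ![Y, Z] - b Y ![X, Z] + b Z ![X, Y] := by
  rw [ContinuousAlternatingMap.alternatizeUncurryFin_apply, Fin.sum_univ_three]
  have e0 : Fin.removeNth 0 ![X, Y, Z] = ![Y, Z] := by ext i; fin_cases i <;> rfl
  have e1 : Fin.removeNth 1 ![X, Y, Z] = ![X, Z] := by ext i; fin_cases i <;> rfl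
  have e2 : Fin.removeNth 2 ![X, Y, Z] = ![X, Y] := by ext i; fin_cases i <;> rfl
  rw [e0, e1, e2]
  simp [sub_eq_add_neg]

variable [IsManifold 𝓘(ℝ, E) ∞ M]

lemma extD_toOneForm_apply {η : (x : M) → (TangentSpace 𝓘(ℝ, E) x →L[ℝ] ℝ)} {x : M}
    (hη : DifferentiableAt ℝ (covecInChart η x) (extChartAt 𝓘(ℝ, E) x x)) (X Y : E) :
    extD (toOneForm η) x ![X, Y] =
      fderiv ℝ (covecInChart η x) (extChartAt 𝓘(ℝ, E) x x) X Y -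
        fderiv ℝ (covecInChart η x) (extChartAt 𝓘(ℝ, E) x x) Y X := by
  let L := ContinuousAlternatingMap.ofSubsingletonLIE (𝕜 := ℝ) (E := E) (F := ℝ) (0 : Fin 1)
  have e : formInChart (toOneForm η) x = fun y => L (covecInChart η x y) := by
    funext y
    ext v
    rfl
  rw [extD_eq, e]
  refine (extDeriv_one_apply _ _ X Y).trans ?_
  have h := (L.toContinuousLinearEquiv : (E →L[ℝ] ℝ) →L[ℝ] E [⋀^Fin 1]→L[ℝ] ℝ).hasFDerivAt.comp _
    hη.hasFDerivAt
  have h' := h.fderiv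
  change fderiv ℝ (fun y => L (covecInChart η x y)) _ = _ at h'
  rw [h']
  rfl

lemma dFun_eq {f : M → ℝ} {g : E → ℝ} {x : M}
    (hg : DifferentiableAt ℝ g (extChartAt 𝓘(ℝ, E) x x))
    (h : ∀ y ∈ (extChartAt 𝓘(ℝ, E) x).target, f ((extChartAt 𝓘(ℝ, E) x).symm y) = g y) :
    dFun f x = fderiv ℝ g (extChartAt 𝓘(ℝ, E) x x) := by
  have e : f =ᶠ[nhds x] g ∘ extChartAt 𝓘(ℝ, E) x := by
    filter_upwards [extChartAt_source_mem_nhds (I := 𝓘(ℝ, E)) x] with z hz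
    rw [Function.comp_apply, ← h _ ((extChartAt 𝓘(ℝ, E) x).map_source hz),
      (extChartAt 𝓘(ℝ, E) x).left_inv hz]
  unfold dFun
  rw [e.mfderiv_eq, mfderiv_comp x hg.mdifferentiableAt
    (mdifferentiableAt_extChartAt (mem_chart_source E x)), mfderiv_extChartAt_self,
    mfderiv_eq_fderiv]
  rfl

lemma covecInChart_vecInChart (η : (x : M) → (TangentSpace 𝓘(ℝ, E) x →L[ℝ] ℝ))
    (X : (x : M) → TangentSpace 𝓘(ℝ, E) x) (x₀ : M) {y : E}
    (hy : y ∈ (extChartAt 𝓘(ℝ, E) x₀).target) :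
    covecInChart η x₀ y (vecInChart X x₀ y) =
      η ((extChartAt 𝓘(ℝ, E) x₀).symm y) (X ((extChartAt 𝓘(ℝ, E) x₀).symm y)) :=
  congrArg _ (mfderiv_symm_mfderiv x₀ hy _)

lemma mpullbackWithin_symm_eq (X : (x : M) → TangentSpace 𝓘(ℝ, E) x) (x₀ : M) {y : E}
    (hy : y ∈ (extChartAt 𝓘(ℝ, E) x₀).target) :
    VectorField.mpullbackWithin 𝓘(ℝ, E) 𝓘(ℝ, E) (extChartAt 𝓘(ℝ, E) x₀).symm X univ y =
      vecInChart X x₀ y := by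
  rw [VectorField.mpullbackWithin_apply, mfderivWithin_univ]
  exact inverse_apply_of_leftRightInverse (E := E) (mfderiv_symm_mfderiv x₀ hy) (mfderiv_mfderiv_symm x₀ hy) _

lemma mlieBracket_eq {X Y : (x : M) → TangentSpace 𝓘(ℝ, E) x} {x : M} :
    VectorField.mlieBracket 𝓘(ℝ, E) X Y x =
      fderiv ℝ (vecInChart Y x) (extChartAt 𝓘(ℝ, E) x x) (X x) -
        fderiv ℝ (vecInChart X x) (extChartAt 𝓘(ℝ, E) x x) (Y x) := by
  have e : ∀ X : (x : M) → TangentSpace 𝓘(ℝ, E) x,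
      VectorField.mpullbackWithin 𝓘(ℝ, E) 𝓘(ℝ, E) (extChartAt 𝓘(ℝ, E) x).symm X univ
        =ᶠ[nhds (extChartAt 𝓘(ℝ, E) x x)] vecInChart X x := fun X => by
    filter_upwards [(isOpen_extChartAt_target (I := 𝓘(ℝ, E)) x).mem_nhds
      (mem_extChartAt_target x)] with y hy
    exact mpullbackWithin_symm_eq X x hy
  rw [VectorField.mlieBracket, VectorField.mlieBracketWithin_apply, mfderiv_extChartAt_self]
  simp only [ModelWithCorners.range_eq_univ, preimage_univ, inter_univ]
  have h := Filter.EventuallyEq.lieBracket_vectorField_eq (𝕜 := ℝ) (E := E) (e X) (e Y)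
  change _ = fderiv ℝ (vecInChart Y x) _ (vecInChart X x (extChartAt 𝓘(ℝ, E) x x)) -
    fderiv ℝ (vecInChart X x) _ (vecInChart Y x (extChartAt 𝓘(ℝ, E) x x)) at h
  rw [vecInChart_self, vecInChart_self] at h
  have h0 := congrFun (VectorField.lieBracketWithin_univ (𝕜 := ℝ) (E := E)
    (V := VectorField.mpullbackWithin 𝓘(ℝ, E) 𝓘(ℝ, E) (extChartAt 𝓘(ℝ, E) x).symm X univ)
    (W := VectorField.mpullbackWithin 𝓘(ℝ, E) 𝓘(ℝ, E) (extChartAt 𝓘(ℝ, E) x).symm Y univ))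
    (extChartAt 𝓘(ℝ, E) x x)
  exact (congrArg _ (h0.trans h)).trans 
    (inverse_apply_of_leftRightInverse (A := .id ℝ E) (B := .id ℝ E) (fun _ => rfl) (fun _ => rfl) _)

/-- The derivative at `x` of a section of `T ⊕ T*` in the chart at `x`. -/
def fieldDeriv (u : GenField E M) (x : M) : E →L[ℝ] Gen E :=
  fderiv ℝ (fieldInChart u x) (extChartAt 𝓘(ℝ, E) x x)

variable [FiniteDimensional ℝ E]

section

variable {u v : GenField E M} (hu : IsSmoothField u) (hv : IsSmoothField v) (x : M)

include hu in
lemma IsSmoothField.hasFDerivAt_vecInChart :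
    HasFDerivAt (vecInChart (fun y => (u y).1) x)
      (ContinuousLinearMap.fst ℝ E (E →L[ℝ] ℝ) ∘L fieldDeriv u x) (extChartAt 𝓘(ℝ, E) x x) :=
  (hu.differentiableAt x).hasFDerivAt.fst

include hu in
lemma IsSmoothField.hasFDerivAt_covecInChart :
    HasFDerivAt (covecInChart (fun y => (u y).2) x)
      (ContinuousLinearMap.snd ℝ E (E →L[ℝ] ℝ) ∘L fieldDeriv u x) (extChartAt 𝓘(ℝ, E) x x) :=
  (hu.differentiableAt x).hasFDerivAt.snd

include hu hv in
lemma IsSmoothField.hasFDerivAt_pairing : HasFDerivAt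
    (fun y => covecInChart (fun y => (u y).2) x y (vecInChart (fun y => (v y).1) x y))
    ((u x).2 ∘L ContinuousLinearMap.fst ℝ E (E →L[ℝ] ℝ) ∘L fieldDeriv v x +
      (ContinuousLinearMap.snd ℝ E (E →L[ℝ] ℝ) ∘L fieldDeriv u x).flip (v x).1)
    (extChartAt 𝓘(ℝ, E) x x) := by
  have h := (hu.hasFDerivAt_covecInChart x).clm_apply (hv.hasFDerivAt_vecInChart x)
  rwa [vecInChart_self (fun y => (v y).1), covecInChart_self (fun y => (u y).2)] at h

include hu hv in
lemma IsSmoothField.dFun_pairing_apply (Z : E) :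
    dFun (fun y => (u y).2 (v y).1) x Z =
      (u x).2 (fieldDeriv v x Z).1 + (fieldDeriv u x Z).2 (v x).1 := by
  have h := hu.hasFDerivAt_pairing hv x
  rw [dFun_eq h.differentiableAt fun y hy =>
    (covecInChart_vecInChart (fun y => (u y).2) (fun y => (v y).1) x hy).symm, h.fderiv]
  rfl

include hu hv in
lemma IsSmoothField.dFun_sub_apply (Z : E) :
    dFun (fun y => (u y).2 (v y).1 - (v y).2 (u y).1) x Z =
      (u x).2 (fieldDeriv v x Z).1 + (fieldDeriv u x Z).2 (v x).1 -
        ((v x).2 (fieldDeriv u x Z).1 + (fieldDeriv v x Z).2 (u x).1) := by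
  have h := (hu.hasFDerivAt_pairing hv x).sub (hv.hasFDerivAt_pairing hu x)
  rw [dFun_eq h.differentiableAt fun y hy => congrArg₂ (· - ·)
    (covecInChart_vecInChart (fun y => (u y).2) (fun y => (v y).1) x hy).symm
    (covecInChart_vecInChart (fun y => (v y).2) (fun y => (u y).1) x hy).symm, h.fderiv]
  rfl

include hu hv in
lemma IsSmoothField.lieDer_apply (Z : E) :
    lieDer (fun y => (u y).1) (fun y => (v y).2) x Z =
      (fieldDeriv v x (u x).1).2 Z + (v x).2 (fieldDeriv u x Z).1 := by
  have h : lieDer (fun y => (u y).1) (fun y => (v y).2) x Z =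
      contract (extD (toOneForm fun y => (v y).2) x) (u x).1 Z +
        dFun (fun y => (v y).2 (u y).1) x Z := rfl
  have hv' := hv.hasFDerivAt_covecInChart x
  have h' : contract (extD (toOneForm fun y => (v y).2) x) (u x).1 Z =
      (fieldDeriv v x (u x).1).2 Z - (fieldDeriv v x Z).2 (u x).1 := by
    refine (contract_apply _ _ _).trans ?_
    refine (extD_toOneForm_apply hv'.differentiableAt (u x).1 Z).trans ?_
    rw [hv'.fderiv]
    rfl
  rw [h, h', hv.dFun_pairing_apply hu]
  ring

variable (H : Form E M 3)

include hu hv in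
lemma courant_fst : (courant H u v x).1 =
    (fieldDeriv v x (u x).1).1 - (fieldDeriv u x (v x).1).1 := by
  refine mlieBracket_eq.trans ?_
  rw [(hu.hasFDerivAt_vecInChart x).fderiv, (hv.hasFDerivAt_vecInChart x).fderiv]
  rfl

include hu hv in
lemma courant_snd_apply (Z : E) : (courant H u v x).2 Z =
    (fieldDeriv v x (u x).1).2 Z - (fieldDeriv u x (v x).1).2 Z +
      (1 / 2 : ℝ) * ((v x).2 (fieldDeriv u x Z).1 - (u x).2 (fieldDeriv v x Z).1 +
        (fieldDeriv u x Z).2 (v x).1 - (fieldDeriv v x Z).2 (u x).1) +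
      H x ![(u x).1, (v x).1, Z] := by
  have h : (courant H u v x).2 Z = lieDer (fun y => (u y).1) (fun y => (v y).2) x Z -
      lieDer (fun y => (v y).1) (fun y => (u y).2) x Z +
      (1 / 2 : ℝ) * dFun (fun y => (u y).2 (v y).1 - (v y).2 (u y).1) x Z +
      contract₃ (H x) (u x).1 (v x).1 Z := rfl
  rw [h, hu.lieDer_apply hv, hv.lieDer_apply hu, hu.dFun_sub_apply hv]
  erw [contract₃_apply (H x)]
  ring

end

end CourantInChart

/-! ### Gauge transformations of the Courant bracket -/

section Gauge

variable {E : Type*} [NormedAddCommGroup E] [NormedSpace ℝ E]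
  {M : Type*} [TopologicalSpace M] [ChartedSpace E M]

lemma map_swap₂ (K : E [⋀^Fin 2]→L[ℝ] ℝ) (X Y : E) : K ![Y, X] = -K ![X, Y] := by
  have := K.map_swap ![X, Y] (i := 0) (j := 1) (by decide)
  refine Eq.trans ?_ this
  change K _ = K _
  congr 1
  ext i; fin_cases i <;> rfl

/-- The Courant bracket of two sections of `T ⊕ T*` in terms of their values and derivatives. -/
def courantJet (h : E [⋀^Fin 3]→L[ℝ] ℝ) (u v : Gen E) (U V : E →L[ℝ] Gen E) : Gen E :=
  ((V u.1).1 - (U v.1).1,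
    (V u.1).2 - (U v.1).2 +
      (1 / 2 : ℝ) • (v.2 ∘L ContinuousLinearMap.fst ℝ E (E →L[ℝ] ℝ) ∘L U -
        u.2 ∘L ContinuousLinearMap.fst ℝ E (E →L[ℝ] ℝ) ∘L V +
        (ContinuousLinearMap.snd ℝ E (E →L[ℝ] ℝ) ∘L U).flip v.1 -
        (ContinuousLinearMap.snd ℝ E (E →L[ℝ] ℝ) ∘L V).flip u.1) +
      contract₃ h u.1 v.1)

lemma courantJet_fst (h : E [⋀^Fin 3]→L[ℝ] ℝ) (u v : Gen E) (U V : E →L[ℝ] Gen E) :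
    (courantJet h u v U V).1 = (V u.1).1 - (U v.1).1 := rfl

lemma courantJet_snd_apply (h : E [⋀^Fin 3]→L[ℝ] ℝ) (u v : Gen E) (U V : E →L[ℝ] Gen E) (Z : E) :
    (courantJet h u v U V).2 Z = (V u.1).2 Z - (U v.1).2 Z +
      (1 / 2 : ℝ) * (v.2 (U Z).1 - u.2 (V Z).1 + (U Z).2 v.1 - (V Z).2 u.1) +
      h ![u.1, v.1, Z] := by
  rw [← contract₃_apply]
  rfl

lemma courantJet_swap (h : E [⋀^Fin 3]→L[ℝ] ℝ) (u v : Gen E) (U V : E →L[ℝ] Gen E) :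
    courantJet h v u V U = -courantJet h u v U V := by
  refine Prod.ext ?_ (ContinuousLinearMap.ext fun Z => ?_)
  · simp only [Prod.fst_neg, courantJet_fst]
    abel
  · simp only [Prod.snd_neg, courantJet_snd_apply, _root_.neg_apply, map_swap_left h u.1 v.1 Z]
    ring

lemma courantJet_add_left (h : E [⋀^Fin 3]→L[ℝ] ℝ) (u u' v : Gen E) (U U' V : E →L[ℝ] Gen E) :
    courantJet h (u + u') v (U + U') V = courantJet h u v U V + courantJet h u' v U' V := by
  refine Prod.ext ?_ (ContinuousLinearMap.ext fun Z => ?_)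
  · simp only [Prod.fst_add, courantJet_fst, map_add, _root_.add_apply]
    abel
  · have : h ![u.1 + u'.1, v.1, Z] = h ![u.1, v.1, Z] + h ![u'.1, v.1, Z] :=
      h.cons_add ![v.1, Z] u.1 u'.1
    simp only [Prod.fst_add, Prod.snd_add, courantJet_snd_apply, map_add, _root_.add_apply, this]
    ring

lemma courantJet_sub_left (h : E [⋀^Fin 3]→L[ℝ] ℝ) (u u' v : Gen E) (U U' V : E →L[ℝ] Gen E) :
    courantJet h (u - u') v (U - U') V = courantJet h u v U V - courantJet h u' v U' V := by
  have e : U - U' + U' = U := ContinuousLinearMap.ext fun Z => sub_add_cancel _ _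
  rw [eq_sub_iff_add_eq, ← courantJet_add_left, sub_add_cancel, e]

lemma courantJet_add_right (h : E [⋀^Fin 3]→L[ℝ] ℝ) (u v v' : Gen E) (U V V' : E →L[ℝ] Gen E) :
    courantJet h u (v + v') U (V + V') = courantJet h u v U V + courantJet h u v' U V' := by
  rw [courantJet_swap, courantJet_add_left, neg_add, ← courantJet_swap, ← courantJet_swap]

lemma courantJet_sub_right (h : E [⋀^Fin 3]→L[ℝ] ℝ) (u v v' : Gen E) (U V V' : E →L[ℝ] Gen E) :
    courantJet h u (v - v') U (V - V') = courantJet h u v U V - courantJet h u v' U V' := by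
  have e : V - V' + V' = V := ContinuousLinearMap.ext fun Z => sub_add_cancel _ _
  rw [eq_sub_iff_add_eq, ← courantJet_add_right, sub_add_cancel, e]

variable [FiniteDimensional ℝ E]

/-- The derivative of `i_X B` for a section `X + ξ` with value `u` and derivative `U` and a 2-form
with value `b` and derivative `b'`. -/
def gaugeJet (b : E [⋀^Fin 2]→L[ℝ] ℝ) (b' : E →L[ℝ] E [⋀^Fin 2]→L[ℝ] ℝ) (u : Gen E)
    (U : E →L[ℝ] Gen E) : E →L[ℝ] Gen E :=
  ContinuousLinearMap.inr ℝ E (E →L[ℝ] ℝ) ∘L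
    (flat b ∘L ContinuousLinearMap.fst ℝ E (E →L[ℝ] ℝ) ∘L U + (flatL E ∘L b').flip u.1)

lemma gaugeJet_fst (b : E [⋀^Fin 2]→L[ℝ] ℝ) (b' : E →L[ℝ] E [⋀^Fin 2]→L[ℝ] ℝ) (u : Gen E)
    (U : E →L[ℝ] Gen E) (Z : E) : (gaugeJet b b' u U Z).1 = 0 := rfl

lemma gaugeJet_snd (b : E [⋀^Fin 2]→L[ℝ] ℝ) (b' : E →L[ℝ] E [⋀^Fin 2]→L[ℝ] ℝ) (u : Gen E)
    (U : E →L[ℝ] Gen E) (Z Y : E) :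
    (gaugeJet b b' u U Z).2 Y = b ![(U Z).1, Y] + b' Z ![u.1, Y] := by
  rw [← flat_apply, ← flat_apply]
  rfl

/-- The part linear in `B` of the gauge law of the Courant bracket; `b'` is the derivative of `B`,
so its alternatization is `dB`. -/
lemma courantJet_gauge (h : E [⋀^Fin 3]→L[ℝ] ℝ) (b : E [⋀^Fin 2]→L[ℝ] ℝ)
    (b' : E →L[ℝ] E [⋀^Fin 2]→L[ℝ] ℝ) (u v : Gen E) (U V : E →L[ℝ] Gen E) :
    courantJet h (formOp (flat b) u) v (gaugeJet b b' u U) V +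
        courantJet h u (formOp (flat b) v) U (gaugeJet b b' v V) =
      formOp (flat b) (courantJet h u v U V) +
        (0, contract₃ (ContinuousAlternatingMap.alternatizeUncurryFin b') u.1 v.1) := by
  refine Prod.ext ?_ (ContinuousLinearMap.ext fun Z => ?_)
  · simp [courantJet_fst, gaugeJet_fst]
  · have h0 : ∀ X, h ![0, X, Z] = 0 := fun X => h.map_coord_zero 0 rfl
    have h1 : ∀ X, h ![X, 0, Z] = 0 := fun X => h.map_coord_zero 1 rfl
    have hd : ∀ X Y : E, b ![X - Y, Z] = b ![X, Z] - b ![Y, Z] := fun X Y => by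
      simp only [← flat_apply, map_sub, _root_.sub_apply]
    simp only [Prod.snd_add, _root_.add_apply, courantJet_snd_apply, formOp_apply, flat_apply,
      gaugeJet_fst, gaugeJet_snd, map_zero, h0, h1, courantJet_fst, contract₃_apply, hd,
      alternatizeUncurryFin_two_apply, Prod.snd_zero, _root_.zero_apply]
    rw [map_swap₂ b v.1, map_swap₂ b u.1, map_swap₂ (b' Z) u.1 v.1]
    ring

/-- Covectors bracket to zero, so the gauge law has no term quadratic in `B`. -/
lemma courantJet_gauge_gauge (h : E [⋀^Fin 3]→L[ℝ] ℝ) (b : E [⋀^Fin 2]→L[ℝ] ℝ)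
    (b' : E →L[ℝ] E [⋀^Fin 2]→L[ℝ] ℝ) (u v : Gen E) (U V : E →L[ℝ] Gen E) :
    courantJet h (formOp (flat b) u) (formOp (flat b) v) (gaugeJet b b' u U)
      (gaugeJet b b' v V) = 0 := by
  refine Prod.ext ?_ (ContinuousLinearMap.ext fun Z => ?_)
  · simp [courantJet_fst]
  · have h0 : ∀ X, h ![0, X, Z] = 0 := fun X => h.map_coord_zero 0 rfl
    simp [courantJet_snd_apply, gaugeJet_fst, h0]

section

variable (h : E [⋀^Fin 3]→L[ℝ] ℝ) (b : E [⋀^Fin 2]→L[ℝ] ℝ) (b' : E →L[ℝ] E [⋀^Fin 2]→L[ℝ] ℝ)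
  (u v u' v' : Gen E) (U V U' V' : E →L[ℝ] Gen E)

/-- Real part of `[e^{-√-1 B} a, e^{-√-1 B} a'] = e^{-√-1 B} [a, a'] - √-1 dB(πa, πa', ·)` for `a =
u + √-1 v` and `a' = u' + √-1 v'`; `courantJet_gauge_im` is the imaginary part. -/
lemma courantJet_gauge_re :
    courantJet h (u + formOp (flat b) v) (u' + formOp (flat b) v')
          (U + gaugeJet b b' v V) (U' + gaugeJet b b' v' V') -
        courantJet h (v - formOp (flat b) u) (v' - formOp (flat b) u')
          (V - gaugeJet b b' u U) (V' - gaugeJet b b' u' U') =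
      courantJet h u u' U U' - courantJet h v v' V V' +
        formOp (flat b) (courantJet h u v' U V' + courantJet h v u' V U') +
        (0, contract₃ (ContinuousAlternatingMap.alternatizeUncurryFin b') u.1 v'.1 +
          contract₃ (ContinuousAlternatingMap.alternatizeUncurryFin b') v.1 u'.1) := by
  have h1 := courantJet_gauge h b b' u v' U V'
  have h2 := courantJet_gauge h b b' v u' V U'
  simp only [courantJet_add_left, courantJet_add_right, courantJet_sub_left, courantJet_sub_right,
    courantJet_gauge_gauge, map_add]
  rw [← add_zero (0 : E), ← Prod.mk_add_mk]
  rw [eq_sub_of_add_eq h1, eq_sub_of_add_eq h2]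
  abel

lemma courantJet_gauge_im :
    courantJet h (u + formOp (flat b) v) (v' - formOp (flat b) u')
          (U + gaugeJet b b' v V) (V' - gaugeJet b b' u' U') +
        courantJet h (v - formOp (flat b) u) (u' + formOp (flat b) v')
          (V - gaugeJet b b' u U) (U' + gaugeJet b b' v' V') =
      courantJet h u v' U V' + courantJet h v u' V U' -
        formOp (flat b) (courantJet h u u' U U' - courantJet h v v' V V') -
        (0, contract₃ (ContinuousAlternatingMap.alternatizeUncurryFin b') u.1 u'.1 -
          contract₃ (ContinuousAlternatingMap.alternatizeUncurryFin b') v.1 v'.1) := by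
  have h1 := courantJet_gauge h b b' u u' U U'
  have h2 := courantJet_gauge h b b' v v' V V'
  simp only [courantJet_add_left, courantJet_add_right, courantJet_sub_left, courantJet_sub_right,
    courantJet_gauge_gauge, map_sub]
  rw [← sub_zero (0 : E), ← Prod.mk_sub_mk]
  rw [eq_sub_of_add_eq h1, eq_sub_of_add_eq h2]
  abel

end

end Gauge

/-! ### Gauge transformations of smooth sections -/

section GaugeField

variable {E : Type*} [NormedAddCommGroup E] [NormedSpace ℝ E] [FiniteDimensional ℝ E]
  {M : Type*} [TopologicalSpace M] [ChartedSpace E M]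

lemma flat_compContinuousLinearMap (K : E [⋀^Fin 2]→L[ℝ] ℝ) {A : E →L[ℝ] E} {X Y : E}
    (h : A X = Y) (Z : E) : flat (K.compContinuousLinearMap A) X Z = flat K Y (A Z) := by
  subst h
  rw [flat_apply, flat_apply]
  change K _ = K _
  congr 1
  ext i; fin_cases i <;> rfl

/-- The section `i_X B` of `T*` associated to a section `X + ξ` of `T ⊕ T*` and a 2-form `B`. -/
def gauge (B : Form E M 2) (u : GenField E M) : GenField E M :=
  fun x => formOp (E := E) (flat (W := E) (B x)) (u x)

variable [IsManifold 𝓘(ℝ, E) ∞ M]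

lemma courant_eq_courantJet {u v : GenField E M} (hu : IsSmoothField u) (hv : IsSmoothField v)
    (H : Form E M 3) (x : M) :
    courant H u v x = courantJet (E := E) (H x) (u x) (v x) (fieldDeriv u x) (fieldDeriv v x) := by
  refine Prod.ext (courant_fst hu hv x H) (ContinuousLinearMap.ext fun Z => ?_)
  exact (courant_snd_apply hu hv x H Z).trans (courantJet_snd_apply _ _ _ _ _ _).symm

lemma IsSmoothField.sub {u v : GenField E M} (hu : IsSmoothField u) (hv : IsSmoothField v) :
    IsSmoothField (fun x => u x - v x) := by
  rw [isSmoothField_iff] at *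
  exact fun x₀ => ((hu x₀).sub (hv x₀)).congr fun y _ => fieldInChart_sub u v x₀ y

lemma fieldDeriv_add {u v : GenField E M} (hu : IsSmoothField u) (hv : IsSmoothField v) (x : M) :
    fieldDeriv (fun y => u y + v y) x = fieldDeriv u x + fieldDeriv v x := by
  unfold fieldDeriv
  rw [funext (fieldInChart_add u v x)]
  exact fderiv_add (hu.differentiableAt x) (hv.differentiableAt x)

lemma fieldDeriv_sub {u v : GenField E M} (hu : IsSmoothField u) (hv : IsSmoothField v) (x : M) :
    fieldDeriv (fun y => u y - v y) x = fieldDeriv u x - fieldDeriv v x := by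
  unfold fieldDeriv
  rw [funext (fieldInChart_sub u v x)]
  exact fderiv_sub (hu.differentiableAt x) (hv.differentiableAt x)

lemma fieldInChart_gauge (B : Form E M 2) (u : GenField E M) (x₀ : M) {y : E}
    (hy : y ∈ (extChartAt 𝓘(ℝ, E) x₀).target) :
    fieldInChart (gauge B u) x₀ y = (0, flatL E (formInChart B x₀ y) (fieldInChart u x₀ y).1) := by
  refine Prod.ext (map_zero (mfderiv 𝓘(ℝ, E) 𝓘(ℝ, E) (extChartAt 𝓘(ℝ, E) x₀)
    ((extChartAt 𝓘(ℝ, E) x₀).symm y))) (ContinuousLinearMap.ext fun Z => ?_)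
  exact (flat_compContinuousLinearMap (E := E) (B _) (mfderiv_symm_mfderiv x₀ hy _) Z).symm

omit [FiniteDimensional ℝ E] in
lemma clm_comp_contDiffOn {F G : Type*} [NormedAddCommGroup F] [NormedSpace ℝ F]
    [NormedAddCommGroup G] [NormedSpace ℝ G] (L : F →L[ℝ] G) {f : E → F} {s : Set E}
    (hf : ContDiffOn ℝ ∞ f s) : ContDiffOn ℝ ∞ (fun y => L (f y)) s :=
  L.contDiff.comp_contDiffOn hf

lemma IsSmoothField.gauge {B : Form E M 2} (hB : IsSmoothForm B) {u : GenField E M}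
    (hu : IsSmoothField u) : IsSmoothField (gauge B u) := by
  rw [isSmoothField_iff] at *
  intro x₀
  refine ContDiffOn.congr ?_ fun y hy => fieldInChart_gauge B u x₀ hy
  have h1 : ContDiffOn ℝ ∞ (fun y => flatL E (formInChart B x₀ y)) _ :=
    clm_comp_contDiffOn (G := E →L[ℝ] (E →L[ℝ] ℝ)) (flatL E) (hB x₀)
  have h2 : ContDiffOn ℝ ∞ (fun y => (fieldInChart u x₀ y).1) _ :=
    contDiff_fst.comp_contDiffOn (hu x₀)
  exact contDiffOn_const.prodMk (h1.clm_apply h2)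

lemma fieldDeriv_gauge {B : Form E M 2} (hB : IsSmoothForm B) {u : GenField E M}
    (hu : IsSmoothField u) (x : M) :
    fieldDeriv (GenKahler.gauge B u) x = gaugeJet (E := E) (B x)
      (fderiv ℝ (formInChart B x) (extChartAt 𝓘(ℝ, E) x x)) (u x) (fieldDeriv u x) := by
  have hy := (isOpen_extChartAt_target (I := 𝓘(ℝ, E)) x).mem_nhds (mem_extChartAt_target x)
  have h1 := ((hB x).differentiableOn (by simp)).differentiableAt hy |>.hasFDerivAt
  have h1' : HasFDerivAt (fun y => flatL E (formInChart B x y)) _ _ :=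
    HasFDerivAt.comp (F := E [⋀^Fin 2]→L[ℝ] ℝ) (G := E →L[ℝ] (E →L[ℝ] ℝ)) _
      (ContinuousLinearMap.hasFDerivAt (E := E [⋀^Fin 2]→L[ℝ] ℝ) (F := E →L[ℝ] (E →L[ℝ] ℝ)) (flatL E)) h1
  have h2 := (hu.differentiableAt x).hasFDerivAt.fst
  have h4 := ((hasFDerivAt_const (0 : E) _).prodMk (h1'.clm_apply h2)).congr_of_eventuallyEq
    (Filter.eventually_of_mem hy fun y hy => fieldInChart_gauge B u x hy)
  rw [fieldDeriv, h4.fderiv, fieldInChart_self, formInChart_self]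
  rfl

end GaugeField

/-! ### Integrals of families of forms -/

section IntegralForm

lemma clm_intervalIntegral {F G : Type*} [NormedAddCommGroup F] [NormedSpace ℝ F] [CompleteSpace F]
    [NormedAddCommGroup G] [NormedSpace ℝ G] [CompleteSpace G] (L : F →L[ℝ] G) {f : ℝ → F} {a b : ℝ}
    (hf : ContinuousOn f (uIcc a b)) : ∫ s in a..b, L (f s) = L (∫ s in a..b, f s) :=
  L.intervalIntegral_comp_comm hf.intervalIntegrable

variable {E : Type*} [NormedAddCommGroup E] [NormedSpace ℝ E] [FiniteDimensional ℝ E]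
  {M : Type*} [TopologicalSpace M] [ChartedSpace E M]

/-- The value of a form at `x`, as a form on the model space. -/
abbrev formAt {k : ℕ} (α : Form E M k) (x : M) : E [⋀^Fin k]→L[ℝ] ℝ := α x

/-- The integral over `[0, t]` of a curve of 2-forms on the model space. -/
def formIntegral (K : ℝ → E [⋀^Fin 2]→L[ℝ] ℝ) (t : ℝ) : E [⋀^Fin 2]→L[ℝ] ℝ := ∫ s in (0 : ℝ)..t, K s

/-- The integral `∫₀ᵗ K_s ds` of a family of 2-forms. -/
def intForm (K : ℝ → Form E M 2) (t : ℝ) : Form E M 2 :=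
  fun x => formIntegral (E := E) (fun s => formAt (K s) x) t

variable {T : Set ℝ} {K : ℝ → Form E M 2} (hK : IsSmoothFormFamily T K)

include hK

omit [FiniteDimensional ℝ E] in
lemma IsSmoothFormFamily.continuousOn_formInChart (x₀ : M) {y : E}
    (hy : y ∈ (extChartAt 𝓘(ℝ, E) x₀).target) :
    ContinuousOn (fun s => formInChart (K s) x₀ y) T :=
  (hK x₀).continuousOn.comp (f := fun s => (s, y))
    (continuous_id.prodMk continuous_const).continuousOn fun _ hs => ⟨hs, hy⟩

variable [IsManifold 𝓘(ℝ, E) ∞ M]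

omit [FiniteDimensional ℝ E] in
lemma IsSmoothFormFamily.continuousOn (x : M) :
    ContinuousOn (fun s => formAt (K s) x) T :=
  (hK.continuousOn_formInChart x (mem_extChartAt_target x)).congr fun s _ =>
    (formInChart_self (K s) x).symm

variable (hT : T.OrdConnected) (h0 : (0 : ℝ) ∈ T)

include hT h0

omit [FiniteDimensional ℝ E] in
lemma IsSmoothFormFamily.hasDerivWithinAt_intForm {t : ℝ} (ht : t ∈ T) (x : M) :
    HasDerivWithinAt (fun t => formAt (intForm K t) x) (formAt (K t) x) T t :=
  hasDerivWithinAt_integral (F := E [⋀^Fin 2]→L[ℝ] ℝ) hT h0 (hK.continuousOn x) ht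

omit [FiniteDimensional ℝ E] in
lemma IsSmoothFormFamily.formInChart_intForm {t : ℝ} (ht : t ∈ T) (x₀ : M) (y : E) :
    formInChart (intForm K t) x₀ y = ∫ s in (0 : ℝ)..t, formInChart (K s) x₀ y := by
  have hc := hK.continuousOn ((extChartAt 𝓘(ℝ, E) x₀).symm y)
  let A : E →L[ℝ] E := mfderiv 𝓘(ℝ, E) 𝓘(ℝ, E) (extChartAt 𝓘(ℝ, E) x₀).symm y
  let L : (E [⋀^Fin 2]→L[ℝ] ℝ) →L[ℝ] (E [⋀^Fin 2]→L[ℝ] ℝ) :=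
    ContinuousAlternatingMap.compContinuousLinearMapCLM A
  exact (clm_intervalIntegral (F := E [⋀^Fin 2]→L[ℝ] ℝ) (G := E [⋀^Fin 2]→L[ℝ] ℝ) L
    (hc.mono (hT.uIcc_subset h0 ht))).symm

variable (hT' : T.Nontrivial)

include hT'

lemma IsSmoothFormFamily.isSmoothForm_intForm {t : ℝ} (ht : t ∈ T) :
    IsSmoothForm (intForm K t) := fun x₀ =>
  (contDiffOn_integral (F := E [⋀^Fin 2]→L[ℝ] ℝ) hT hT' (isOpen_extChartAt_target x₀) h0 ht
    (hK x₀)).congr fun y _ => hK.formInChart_intForm hT h0 ht x₀ y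

/-- The exterior derivative commutes with the integral over `t`. One continuous curve `g` serves
both formulas, so that closedness passes from `K` to `∫ K` by integration and back by
differentiation. -/
lemma IsSmoothFormFamily.exists_extD (x : M) :
    ∃ g : ℝ → E [⋀^Fin 3]→L[ℝ] ℝ, ContinuousOn g T ∧ (∀ t ∈ T, formAt (extD (K t)) x = g t) ∧
      ∀ t ∈ T, formAt (extD (intForm K t)) x = ∫ s in (0 : ℝ)..t, g s := by
  have hU := isOpen_extChartAt_target (I := 𝓘(ℝ, E)) x
  have hx := mem_extChartAt_target (I := 𝓘(ℝ, E)) x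
  let p : ℝ → E →L[ℝ] E [⋀^Fin 2]→L[ℝ] ℝ := fun s => partialSnd T (extChartAt 𝓘(ℝ, E) x).target
    (fun p : ℝ × E => formInChart (K p.1) x p.2) (s, extChartAt 𝓘(ℝ, E) x x)
  have hp : ContinuousOn p T :=
    (contDiffOn_partialSnd (F := E [⋀^Fin 2]→L[ℝ] ℝ) hT hT' hU (hK x)).continuousOn.comp
      (f := fun s => (s, extChartAt 𝓘(ℝ, E) x x))
      (continuous_id.prodMk continuous_const).continuousOn fun _ hs => ⟨hs, hx⟩
  let A := ContinuousAlternatingMap.alternatizeUncurryFinCLM (n := 2) ℝ E ℝ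
  refine ⟨fun s => A (p s), A.continuous.comp_continuousOn hp, fun t ht => ?_, fun t ht => ?_⟩
  · have h := hasFDerivAt_partialSnd (F := E [⋀^Fin 2]→L[ℝ] ℝ) hU (hK x) ht hx
    rw [formAt, extD_eq, extDeriv]
    exact congrArg A h.fderiv
  · have h := hasFDerivAt_integral (F := E [⋀^Fin 2]→L[ℝ] ℝ) hT hT' hU (hK x) h0 ht hx
    rw [formAt, extD_eq, extDeriv, funext (hK.formInChart_intForm hT h0 ht x)]
    refine (congrArg A h.fderiv).trans ?_
    exact (clm_intervalIntegral (F := E →L[ℝ] E [⋀^Fin 2]→L[ℝ] ℝ) (G := E [⋀^Fin 3]→L[ℝ] ℝ) A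
      (hp.mono (hT.uIcc_subset h0 ht))).symm

lemma IsSmoothFormFamily.extD_intForm_eq_zero {x : M} (h : ∀ t ∈ T, extD (K t) x = 0) {t : ℝ}
    (ht : t ∈ T) : extD (intForm K t) x = 0 := by
  obtain ⟨g, -, hg, hg'⟩ := hK.exists_extD hT h0 hT' x
  refine (hg' t ht).trans ?_
  refine (intervalIntegral.integral_congr fun s hs => ?_).trans intervalIntegral.integral_zero
  exact (hg s (hT.uIcc_subset h0 ht hs)).symm.trans (h s (hT.uIcc_subset h0 ht hs))

lemma IsSmoothFormFamily.extD_eq_zero {x : M} (h : ∀ t ∈ T, extD (intForm K t) x = 0) {t : ℝ}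
    (ht : t ∈ T) : extD (K t) x = 0 := by
  obtain ⟨g, hc, hg, hg'⟩ := hK.exists_extD hT h0 hT' x
  have hd := hasDerivWithinAt_integral (F := E [⋀^Fin 3]→L[ℝ] ℝ) hT h0 hc ht
  have hd' : HasDerivWithinAt (fun t => ∫ s in (0 : ℝ)..t, g s) 0 T t :=
    (hasDerivWithinAt_const t T 0).congr (fun s hs => (hg' s hs).symm.trans (h s hs))
      ((hg' t ht).symm.trans (h t ht))
  refine (hg t ht).trans ?_
  exact (uniqueDiffWithinAt_of_ordConnected hT hT' ht).eq_deriv _ hd hd'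

end IntegralForm

/-! ### Gauge transformations and integrability -/

section Integrability

variable {E : Type*} [NormedAddCommGroup E] [NormedSpace ℝ E] [FiniteDimensional ℝ E]
  {M : Type*} [TopologicalSpace M] [ChartedSpace E M]

/-- The value of an endomorphism at `x`, as an endomorphism of the model space. -/
abbrev endoAt (J : GenEndo E M) (x : M) : Gen E →L[ℝ] Gen E := J x

/-- The value of a section of `T ⊕ T*` at `x`, in the model space. -/
abbrev fieldAt (u : GenField E M) (x : M) : Gen E := u x

/-- The transformation `e^{-√-1 B}` maps the `√-1`-eigenbundle of `J₀` to that of `J`. -/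
def IsGauge (B : Form E M 2) (J₀ J : GenEndo E M) : Prop :=
  ∀ (x : M) (a b : Gen E), endoAt J₀ x a + b = 0 ↔
    endoAt J x (a + formOp (flat (formAt B x)) b) + (b - formOp (flat (formAt B x)) a) = 0

omit [FiniteDimensional ℝ E] in
lemma contract₃_neg_left (f : E [⋀^Fin 3]→L[ℝ] ℝ) (X Y : E) :
    contract₃ f (-X) Y = -contract₃ f X Y := by
  refine ContinuousLinearMap.ext fun Z => ?_
  rw [_root_.neg_apply, contract₃_apply, contract₃_apply, ← neg_one_smul ℝ X]
  exact (f.cons_smul ![Y, Z] (-1 : ℝ) X).trans (by simp)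

omit [FiniteDimensional ℝ E] in
lemma contract₃_neg_right (f : E [⋀^Fin 3]→L[ℝ] ℝ) (X Y : E) :
    contract₃ f X (-Y) = -contract₃ f X Y := by
  have h : ∀ X Y : E, contract₃ f X Y = -contract₃ f Y X := fun X Y =>
    ContinuousLinearMap.ext fun Z => by
      rw [_root_.neg_apply, contract₃_apply, contract₃_apply, map_swap_left]
  rw [h, contract₃_neg_left, h X]

omit [FiniteDimensional ℝ E] in
-- Subtracting the transported eigenvector equation of `R + √-1 I` from `h` leaves the covector `p -
-- √-1 q` in the eigenspace of `J`. Since `e^{-√-1 B}` fixes covectors, it also lies in the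
-- eigenspace of `J₀`.
lemma apply_eq_of_gauge {J₀ J : Gen E →L[ℝ] Gen E} {b : E →L[ℝ] (E →L[ℝ] ℝ)}
    (hsq : ∀ v, J₀ (J₀ v) = -v)
    (hg : ∀ v w, J₀ v + w = 0 ↔ J (v + formOp b w) + (w - formOp b v) = 0) {R I : Gen E}
    (h₀ : J₀ R + I = 0) {p q : E →L[ℝ] ℝ}
    (h : J (R + formOp b I + (0, p)) + (I - formOp b R - (0, q)) = 0) : J₀ (0, q) = -(0, p) := by
  have h1 := (hg R I).1 h₀
  have h2 : J (0, p) - (0, q) = 0 := by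
    rw [map_add] at h
    rw [← sub_eq_zero.2 (h.trans h1.symm)]
    abel
  have h3 : J₀ (0, p) + -(0, q) = 0 := by
    rw [hg]
    simpa [sub_eq_add_neg] using h2
  rw [← hsq, eq_of_sub_eq_zero (a := J₀ (0, p)) (by rw [sub_eq_add_neg, h3])]

lemma gauge_add_gauge (B : Form E M 2) (u v : GenField E M) :
    gauge B (fun y => v y + gauge B u y) = gauge B v := by
  have h : ∀ (b : E →L[ℝ] (E →L[ℝ] ℝ)) (p q : Gen E), formOp b (q + formOp b p) = formOp b q :=
    fun b p q => by simp
  exact funext fun x => h (flat (formAt B x)) (u x) (v x)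

lemma gauge_sub_gauge (B : Form E M 2) (u v : GenField E M) :
    gauge B (fun y => u y - gauge B v y) = gauge B u := by
  have h : ∀ (b : E →L[ℝ] (E →L[ℝ] ℝ)) (p q : Gen E), formOp b (q - formOp b p) = formOp b q :=
    fun b p q => by simp
  exact funext fun x => h (flat (formAt B x)) (v x) (u x)

variable [IsManifold 𝓘(ℝ, E) ∞ M]

omit [FiniteDimensional ℝ E] in
lemma IsGenAlmostComplex.isEigenSection_iff {J : GenEndo E M} (hJ : IsGenAlmostComplex J)
    {u v : GenField E M} : IsEigenSection J u v ↔ ∀ x, endoAt J x (fieldAt u x) + fieldAt v x = 0 := by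
  refine forall_congr' fun x => ⟨fun h => ?_, fun h => ?_⟩
  · exact (congrArg (· + v x) h.1).trans (neg_add_cancel _)
  · have h1 : J x (u x) = -(v x) := eq_neg_of_add_eq_zero_left h
    have h2 := hJ.sq x (u x)
    rw [h1, map_neg] at h2
    exact ⟨h1, neg_injective h2⟩

section

variable {B : Form E M 2} (hB : IsSmoothForm B) {u v u' v' : GenField E M} (hu : IsSmoothField u)
  (hv : IsSmoothField v) (hu' : IsSmoothField u') (hv' : IsSmoothField v') (H : Form E M 3) (x : M)

include hB hu hv hu' hv'

lemma courant_gauge_re :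
    fieldAt (courant H (fun y => u y + gauge B v y) (fun y => u' y + gauge B v' y)) x -
        fieldAt (courant H (fun y => v y - gauge B u y) (fun y => v' y - gauge B u' y)) x =
      fieldAt (courant H u u') x - fieldAt (courant H v v') x + formOp (E := E) (flat (formAt B x))
        (fieldAt (courant H u v') x + fieldAt (courant H v u') x) +
        (0, contract₃ (formAt (extD B) x) (u x).1 (v' x).1 +
          contract₃ (formAt (extD B) x) (v x).1 (u' x).1) := by
  simp only [fieldAt]
  rw [courant_eq_courantJet (hu.add (hv.gauge hB)) (hu'.add (hv'.gauge hB)),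
    courant_eq_courantJet (hv.sub (hu.gauge hB)) (hv'.sub (hu'.gauge hB)),
    courant_eq_courantJet hu hu', courant_eq_courantJet hv hv', courant_eq_courantJet hu hv',
    courant_eq_courantJet hv hu', fieldDeriv_add hu (hv.gauge hB), fieldDeriv_add hu' (hv'.gauge hB),
    fieldDeriv_sub hv (hu.gauge hB), fieldDeriv_sub hv' (hu'.gauge hB), fieldDeriv_gauge hB hu,
    fieldDeriv_gauge hB hv, fieldDeriv_gauge hB hu', fieldDeriv_gauge hB hv', formAt, formAt, extD_eq]
  exact courantJet_gauge_re (E := E) (H x) (B x) _ (u x) (v x) (u' x) (v' x) _ _ _ _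

lemma courant_gauge_im :
    fieldAt (courant H (fun y => u y + gauge B v y) (fun y => v' y - gauge B u' y)) x +
        fieldAt (courant H (fun y => v y - gauge B u y) (fun y => u' y + gauge B v' y)) x =
      fieldAt (courant H u v') x + fieldAt (courant H v u') x - formOp (E := E) (flat (formAt B x))
        (fieldAt (courant H u u') x - fieldAt (courant H v v') x) -
        (0, contract₃ (formAt (extD B) x) (u x).1 (u' x).1 -
          contract₃ (formAt (extD B) x) (v x).1 (v' x).1) := by
  simp only [fieldAt]
  rw [courant_eq_courantJet (hu.add (hv.gauge hB)) (hv'.sub (hu'.gauge hB)),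
    courant_eq_courantJet (hv.sub (hu.gauge hB)) (hu'.add (hv'.gauge hB)),
    courant_eq_courantJet hu hu', courant_eq_courantJet hv hv', courant_eq_courantJet hu hv',
    courant_eq_courantJet hv hu', fieldDeriv_add hu (hv.gauge hB), fieldDeriv_add hu' (hv'.gauge hB),
    fieldDeriv_sub hv (hu.gauge hB), fieldDeriv_sub hv' (hu'.gauge hB), fieldDeriv_gauge hB hu,
    fieldDeriv_gauge hB hv, fieldDeriv_gauge hB hu', fieldDeriv_gauge hB hv', formAt, formAt, extD_eq]
  exact courantJet_gauge_im (E := E) (H x) (B x) _ (u x) (v x) (u' x) (v' x) _ _ _ _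

end

variable {H : Form E M 3} {J₀ J : GenEndo E M} {B : Form E M 2}

/-- Gauge transformations by closed forms preserve integrability. -/
lemma IsIntegrable.gauge (hint : IsIntegrable H J₀) (h₀ : IsGenAlmostComplex J₀)
    (h : IsGenAlmostComplex J) (hB : IsSmoothForm B) (hg : IsGauge B J₀ J)
    (hd : ∀ x, formAt (extD B) x = 0) : IsIntegrable H J := by
  intro U V U' V' hU hV hU' hV' hUV hUV'
  -- The inverse transformation `e^{√-1 B}` sends `U + √-1 V` to `(U - BV) + √-1 (V + BU)`.
  have key : ∀ {U V : GenField E M}, IsEigenSection J U V →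
      IsEigenSection J₀ (fun y => U y - GenKahler.gauge B V y)
        (fun y => V y + GenKahler.gauge B U y) := by
    intro U V hUV
    rw [h₀.isEigenSection_iff]
    rw [h.isEigenSection_iff] at hUV
    intro x
    refine (hg x _ _).2 (Eq.trans ?_ (hUV x))
    have e1 := congrFun (gauge_add_gauge B U V) x
    have e2 := congrFun (gauge_sub_gauge B U V) x
    change endoAt J x (fieldAt U x - fieldAt (GenKahler.gauge B V) x +
      fieldAt (GenKahler.gauge B (fun y => V y + GenKahler.gauge B U y)) x) +
      (fieldAt V x + fieldAt (GenKahler.gauge B U) x -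
        fieldAt (GenKahler.gauge B (fun y => U y - GenKahler.gauge B V y)) x) = _
    rw [fieldAt, fieldAt, fieldAt, fieldAt, fieldAt, fieldAt, e1, e2]
    exact congrArg₂ (fun a b => endoAt J x a + b) (sub_add_cancel _ _) (add_sub_cancel_right _ _)
  have hu := hU.sub (hV.gauge hB)
  have hv := hV.add (hU.gauge hB)
  have hu' := hU'.sub (hV'.gauge hB)
  have hv' := hV'.add (hU'.gauge hB)
  have hR := hint _ _ _ _ hu hv hu' hv' (key hUV) (key hUV')
  rw [h₀.isEigenSection_iff] at hR
  rw [h.isEigenSection_iff]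
  intro x
  have hRx := (hg x _ _).1 (hR x)
  have e1 := courant_gauge_re hB hu hv hu' hv' H x
  have e2 := courant_gauge_im hB hu hv hu' hv' H x
  simp only [hd, gauge_add_gauge, gauge_sub_gauge, sub_add_cancel, add_sub_cancel_right] at e1 e2
  have z : ∀ X Y : E, contract₃ (0 : E [⋀^Fin 3]→L[ℝ] ℝ) X Y = 0 := fun X Y =>
    ContinuousLinearMap.ext fun Z => contract₃_apply _ X Y Z
  have z₁ : ∀ (p : Gen E) (X Y X' Y' : E), p + (0, contract₃ (0 : E [⋀^Fin 3]→L[ℝ] ℝ) X Y +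
    contract₃ (0 : E [⋀^Fin 3]→L[ℝ] ℝ) X' Y') = p := fun p X Y X' Y' => by simp [z]
  have z₂ : ∀ (p : Gen E) (X Y X' Y' : E), p - (0, contract₃ (0 : E [⋀^Fin 3]→L[ℝ] ℝ) X Y -
    contract₃ (0 : E [⋀^Fin 3]→L[ℝ] ℝ) X' Y') = p := fun p X Y X' Y' => by simp [z]
  refine Eq.trans ?_ hRx
  exact congrArg₂ (fun a b => endoAt J x a + b) (e1.trans (z₁ _ _ _ _ _)) (e2.trans (z₂ _ _ _ _ _))

/-- If both structures related by a gauge transformation are integrable, then the contractions of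
the exterior derivative of the 2-form with eigenvectors are eigenvectors. -/
lemma IsIntegrable.contract_extD [T2Space M] (hint₀ : IsIntegrable H J₀) (hint : IsIntegrable H J)
    (h₀ : IsGenAlmostComplex J₀) (h : IsGenAlmostComplex J) (hB : IsSmoothForm B)
    (hg : IsGauge B J₀ J) (x : M) (a c : Gen E) :
    endoAt J₀ x (0, contract₃ (formAt (extD B) x) a.1 c.1 -
        contract₃ (formAt (extD B) x) (endoAt J₀ x a).1 (endoAt J₀ x c).1) =
      (0, contract₃ (formAt (extD B) x) a.1 (endoAt J₀ x c).1 +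
        contract₃ (formAt (extD B) x) (endoAt J₀ x a).1 c.1) := by
  obtain ⟨u, hu, rfl⟩ := exists_isSmoothField x a
  obtain ⟨u', hu', rfl⟩ := exists_isSmoothField x c
  have hv := (h₀.smooth.apply hu).neg
  have hv' := (h₀.smooth.apply hu').neg
  -- Every real section `u` is the real part of the eigensection `u - √-1 J₀ u`, so arbitrary values
  -- `a` and `c` at `x` can be tested.
  have heig : ∀ u : GenField E M, IsEigenSection J₀ u (fun y => -J₀ y (u y)) := fun u =>
    h₀.isEigenSection_iff.2 fun x => add_neg_cancel (endoAt J₀ x (fieldAt u x))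
  have hgeig : ∀ u : GenField E M, IsEigenSection J
      (fun y => u y + GenKahler.gauge B (fun y => -J₀ y (u y)) y)
      (fun y => -J₀ y (u y) - GenKahler.gauge B u y) := fun u =>
    h.isEigenSection_iff.2 fun x => (hg x _ _).1 (h₀.isEigenSection_iff.1 (heig u) x)
  have hR := h₀.isEigenSection_iff.1 (hint₀ _ _ _ _ hu hv hu' hv' (heig u) (heig u')) x
  have hR' := h.isEigenSection_iff.1 (hint _ _ _ _ (hu.add (hv.gauge hB)) (hv.sub (hu.gauge hB))
    (hu'.add (hv'.gauge hB)) (hv'.sub (hu'.gauge hB)) (hgeig u) (hgeig u')) x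
  have e := congrArg₂ (fun a b => endoAt J x a + b) (courant_gauge_re hB hu hv hu' hv' H x)
    (courant_gauge_im hB hu hv hu' hv' H x)
  have hfin := apply_eq_of_gauge (E := E) (h₀.sq x) (hg x) hR (e.symm.trans hR')
  have key : ∀ (J : Gen E →L[ℝ] Gen E) (f : E [⋀^Fin 3]→L[ℝ] ℝ) (a c a' c' : Gen E),
      J (0, contract₃ f a.1 c.1 - contract₃ f (-a').1 (-c').1) =
        -(0, contract₃ f a.1 (-c').1 + contract₃ f (-a').1 c.1) →
      J (0, contract₃ f a.1 c.1 - contract₃ f a'.1 c'.1) =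
        (0, contract₃ f a.1 c'.1 + contract₃ f a'.1 c.1) := fun J f a c a' c' h => by
    simp only [Prod.fst_neg, contract₃_neg_left, contract₃_neg_right, neg_neg] at h
    rw [h, Prod.neg_mk, neg_zero, neg_add, neg_neg, neg_neg]
  exact key _ _ _ _ _ _ hfin

end Integrability

/-! ### Flows of pairs of generalized almost complex structures -/

section Flow

variable {E : Type*} [NormedAddCommGroup E] [NormedSpace ℝ E] [FiniteDimensional ℝ E]
  {M : Type*} [TopologicalSpace M] [ChartedSpace E M] [IsManifold 𝓘(ℝ, E) ∞ M]

omit [FiniteDimensional ℝ E] in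
lemma IsGenAlmostComplex.isFiberPair {J₁ J₂ : GenEndo E M} (h₁ : IsGenAlmostComplex J₁)
    (h₂ : IsGenAlmostComplex J₂) {x : M} (hp : IsPositivePair (J₁ x) (J₂ x)) :
    IsFiberPair (endoAt J₁ x) (endoAt J₂ x) where
  sq₁ := h₁.sq x
  sq₂ := h₂.sq x
  orth₁ := h₁.orth x
  orth₂ := h₂.orth x
  pos := hp

omit [IsManifold 𝓘(ℝ, E) ∞ M] in
lemma formOp_flat_intForm_zero (K : ℝ → Form E M 2) (x : M) (v : Gen E) :
    formOp (flat (formAt (intForm K 0) x)) v = 0 := by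
  have h : formAt (intForm K 0) x = 0 := intervalIntegral.integral_same
  rw [h, formOp_apply, ← flatL_apply, map_zero]
  rfl

variable {T : Set ℝ} (hT : T.OrdConnected) (h0 : (0 : ℝ) ∈ T) {K : ℝ → Form E M 2}
  (hK : IsSmoothFormFamily T K)

include hT h0 hK

/-- The form `∫₀ᵗ K` vanishes at `t = 0`; transport from `0` to `t` and back gives the two
implications. -/
lemma isGauge_intForm {J : ℝ → GenEndo E M} (hac : ∀ t ∈ T, IsGenAlmostComplex (J t))
    (hev : ∀ t ∈ T, ∀ x, HasDerivWithinAt (fun s => J s x) (Phi (K t x) (J t x)) T t) {t : ℝ}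
    (ht : t ∈ T) : IsGauge (intForm K t) (J 0) (J t) := by
  intro x a b
  have key := fun {s t : ℝ} (hs : s ∈ T) (ht : t ∈ T) => eigen_transport (E := E)
    (J := fun s => endoAt (J s) x) (K := fun s => formAt (K s) x)
    (B := fun s => formAt (intForm K s) x) hT (fun t ht => (hac t ht).sq x) (hK.continuousOn x)
    (fun t ht => hev t ht x) (fun t ht => hK.hasDerivWithinAt_intForm hT h0 ht x) a b hs ht
  have e : endoAt (J 0) x a + b = endoAt (J 0) x (a + formOp (flat (formAt (intForm K 0) x)) b) +
      (b - formOp (flat (formAt (intForm K 0) x)) a) := by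
    simp only [formOp_flat_intForm_zero, add_zero, sub_zero]
  rw [e]
  exact ⟨key h0 ht, key ht h0⟩

end Flow

end GenKahler

end

/-! ### The main theorem -/

theorem theoremt
    {E : Type*} [NormedAddCommGroup E] [NormedSpace ℝ E] [FiniteDimensional ℝ E]
    {M : Type*} [TopologicalSpace M] [T2Space M] [SecondCountableTopology M]
    [ChartedSpace E M] [IsManifold 𝓘(ℝ, E) ∞ M]
    -- a closed 3-form, which twists the Courant bracket
    (H : GenKahler.Form E M 3) (hH : GenKahler.IsSmoothForm H)
    (hdH : ∀ x, GenKahler.extD H x = 0)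
    -- the parameter runs through a nondegenerate interval that contains `0`
    (T : Set ℝ) (hT : T.OrdConnected) (hT' : T.Nontrivial) (h0 : (0 : ℝ) ∈ T)
    -- a one-parameter family of pairs of generalized almost complex structures
    (J₁ J₂ : ℝ → GenKahler.GenEndo E M)
    (hJ₁ : GenKahler.IsSmoothEndoFamily T J₁) (hJ₂ : GenKahler.IsSmoothEndoFamily T J₂)
    (hac₁ : ∀ t ∈ T, GenKahler.IsGenAlmostComplex (J₁ t))
    (hac₂ : ∀ t ∈ T, GenKahler.IsGenAlmostComplex (J₂ t))
    -- the initial pair is generalized Kähler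
    (hinit : GenKahler.IsGenKahler H (J₁ 0) (J₂ 0))
    -- a one-parameter family of 2-forms
    (K : ℝ → GenKahler.Form E M 2) (hK : GenKahler.IsSmoothFormFamily T K)
    -- the evolution equations
    (hev₁ : ∀ t ∈ T, ∀ x, HasDerivWithinAt (fun s => J₁ s x)
      (GenKahler.Phi (K t x) (J₁ t x)) T t)
    (hev₂ : ∀ t ∈ T, ∀ x, HasDerivWithinAt (fun s => J₂ s x)
      (GenKahler.Phi (K t x) (J₂ t x)) T t) :
    (∀ t ∈ T, GenKahler.IsGenKahler H (J₁ t) (J₂ t)) ↔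
      ∀ t ∈ T,
        (∀ x, GenKahler.IsOneOne (GenKahler.gualtieriJ (J₁ t x) (J₂ t x)) (K t x)) ∧
        (∀ x, GenKahler.extD (K t) x = 0) ∧
        (∀ x, GenKahler.IsPositivePair (J₁ t x) (J₂ t x)) := by
  have hpair : (∀ t ∈ T, ∀ x, GenKahler.IsPositivePair (J₁ t x) (J₂ t x)) → ∀ x, ∀ t ∈ T,
      GenKahler.IsFiberPair (GenKahler.endoAt (J₁ t) x) (GenKahler.endoAt (J₂ t) x) :=
    fun hp x t ht => (hac₁ t ht).isFiberPair (hac₂ t ht) (hp t ht x)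
  have hB : ∀ t ∈ T, GenKahler.IsSmoothForm (GenKahler.intForm K t) := fun t ht =>
    hK.isSmoothForm_intForm hT h0 hT' ht
  have hg₁ : ∀ t ∈ T, GenKahler.IsGauge (GenKahler.intForm K t) (J₁ 0) (J₁ t) := fun t ht =>
    GenKahler.isGauge_intForm hT h0 hK hac₁ hev₁ ht
  have hg₂ : ∀ t ∈ T, GenKahler.IsGauge (GenKahler.intForm K t) (J₂ 0) (J₂ t) := fun t ht =>
    GenKahler.isGauge_intForm hT h0 hK hac₂ hev₂ ht
  constructor
  · intro hGK
    have hp := hpair fun t ht => (hGK t ht).pos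
    refine fun t ht => ⟨fun x => ?_, fun x => ?_, (hGK t ht).pos⟩
    · exact GenKahler.isOneOne_of_commute (E := E) (J₁ := fun s => GenKahler.endoAt (J₁ s) x)
        (J₂ := fun s => GenKahler.endoAt (J₂ s) x) (K := fun s => GenKahler.formAt (K s) x)
        hT hT' (hp x) (fun t ht => hev₁ t ht x) (fun t ht => hev₂ t ht x)
        (fun t ht => (hGK t ht).comm x) t ht
    -- It suffices that `∫₀ˢ K` is closed for every `s`. The pointwise argument runs in the fibre of
    -- the initial pair, whose eigenbundles contain the contractions of the exterior derivative.
    · refine hK.extD_eq_zero hT h0 hT' (fun s hs => ?_) ht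
      exact (hp x 0 h0).threeForm_eq_zero (fun v => congrArg (fun f => f v) (hinit.comm x)) _
        (hinit.fst.integrable.contract_extD (hGK s hs).fst.integrable hinit.fst.almost
          (hac₁ s hs) (hB s hs) (hg₁ s hs) x)
        (hinit.snd.integrable.contract_extD (hGK s hs).snd.integrable hinit.snd.almost
          (hac₂ s hs) (hB s hs) (hg₂ s hs) x)
  · intro h t ht
    have hp := hpair fun t ht => (h t ht).2.2
    have hd : ∀ x, GenKahler.formAt (GenKahler.extD (GenKahler.intForm K t)) x = 0 := fun x =>
      hK.extD_intForm_eq_zero hT h0 hT' (fun s hs => (h s hs).2.1 x) ht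
    refine ⟨⟨hac₁ t ht, ?_⟩, ⟨hac₂ t ht, ?_⟩, fun x => ?_, (h t ht).2.2⟩
    · exact hinit.fst.integrable.gauge hinit.fst.almost (hac₁ t ht) (hB t ht) (hg₁ t ht) hd
    · exact hinit.snd.integrable.gauge hinit.snd.almost (hac₂ t ht) (hB t ht) (hg₂ t ht) hd
    · exact GenKahler.commute_of_isOneOne (E := E) (J₁ := fun s => GenKahler.endoAt (J₁ s) x)
        (J₂ := fun s => GenKahler.endoAt (J₂ s) x) (K := fun s => GenKahler.formAt (K s) x)
        hT h0 (hp x) (hK.continuousOn x) (fun t ht => hev₁ t ht x) (fun t ht => hev₂ t ht x)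
        (fun t ht => (h t ht).1 x) (hinit.comm x) t ht
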